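/- Let $\epsilon(n)$ be a sequence of real numbers with $\epsilon(n)\to 0$ and $\epsilon(n)n^{1/3}\to\infty$ as $n\to\infty$, and let $p(n)\in[0,1]$ satisfy $p(n)=\frac{1-\epsilon(n)}{n}$ for all sufficiently large $n$. Let $G(n,p(n))$ be the random graph on $n$ labelled vertices in which each pair of distinct vertices is joined by an edge independently with probability $p(n)$, and let $|\mathcal C_\ell|$ be the number of vertices of its $\ell$-th largest connected component (components listed in decreasing order of size, with multiplicity; $|\mathcal C_\ell|=0$ if there are fewer than $\ell$ components). Then for every $\eta>0$ and every integer $\ell\ge 1$, $$\mathbf P\left(\left|\frac{|\mathcal C_\ell|}{2\,\epsilon(n)^{-2}\log\left(n\,\epsilon(n)^3\right)}-1\right|>\eta\right)\to 0\qquad\text{as } n\to\infty.$$ -/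

import Mathlib

open Filter Topology

/-- The list of the numbers of vertices of the connected components of a graph on a finite vertex
set (with multiplicity), in decreasing order. -/
noncomputable def SimpleGraph.componentSizes {V : Type*} [Finite V] (G : SimpleGraph V) : List ℕ :=
  letI : Fintype G.ConnectedComponent := Fintype.ofFinite _
  ((Finset.univ : Finset G.ConnectedComponent).val.map fun C => C.supp.ncard).sort (· ≥ ·)

/-- The number of vertices of the `l`-th largest connected component, for `l ≥ 1`
(ties counted with multiplicity); it is `0` if there are fewer than `l` components. -/
noncomputable def SimpleGraph.componentSize {V : Type*} [Finite V] (G : SimpleGraph V) (l : ℕ) :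
    ℕ :=
  G.componentSizes.getD (l - 1) 0

/-!
A component of size `j` in `G(n, (1 - ε) / n)` costs a factor of about `exp (-ε² j / 2)`, and the
expected number of components of size about `A ε⁻²` is, up to powers of `A`, equal to
`n ε³ exp (-A / 2)`. This passes from large to small at `A = 2 log (n ε³)`, which gives the size of
the `l`-th largest component for every fixed `l`. Write `L = log (n ε³)`.

*Upper bound.* A component on `j` vertices spans at least `j - 1` edges and is determined by at most
`j n` pairs. So if the edge probability is raised from `p = (1 - ε) / n` to `p' = (1 - δ ε) / n`,
the probability that a given set is a component is multiplied by at least about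
`exp ((1 - δ²) ε² j / 2)` (`prob_isComp_le_mul`, `tilt_le_exp`). At `p'` the expected size of the
component of a vertex is at most `1 / (1 - n p') = 1 / (δ ε)` (`sum_prob_reachIn_le`, by a
first-step decomposition), so that the expected number of components of size at least `k` is at most
`n / (δ ε k²)`. Together the two give the factor `n ε³` with the right exponential
(`prob_exists_isComp_le_exp`).

*Lower bound.* Exploring a connected set vertex by vertex gives the bound
`j ^ (j - 2) p ^ (j - 1) (1 - p) ^ (j choose 2)` for the probability that `j` vertices are connected
(`le_prob_reachedFrom`, `le_prob_connIn`), which contains Cayley's count of spanning trees without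
any enumeration of trees. With Stirling's formula the expected number of components with sizes
between `(1 - η) 2 ε⁻² L` and `(1 - η / 2) 2 ε⁻² L` tends to infinity (`le_sum_prob_isComp_Icc`).

*Concentration.* Two disjoint sets `S` and `T` are both components with probability
`P(S) P(T) (1 - p) ^ (-|S| |T|)`, and since `p ≤ 1 / n` this gain is outweighed by the loss of room
for `T` outside `S` (`choose_sub_le`). Hence the variance of the number of components in a range of
sizes is at most its mean, and Chebyshev's inequality applies (`prob_compCount_lt_mul_sq_le`).
-/

namespace RandomGraph

open Finset

/-! ### Expectations over the binomial random graph -/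

section Bernoulli

variable {α : Type*}

/-- The expectation of `f T`, where `T` is the random subset of the finite set `D` that contains
each element independently with probability `p`, as a polynomial in `p`. -/
noncomputable def bernoulliSum (p : ℝ) (D : Finset α) (f : Finset α → ℝ) : ℝ :=
  ∑ T ∈ D.powerset, p ^ #T * (1 - p) ^ (#D - #T) * f T

lemma bernoulliSum_one (p : ℝ) (D : Finset α) : bernoulliSum p D (fun _ => 1) = 1 := by
  simp [bernoulliSum, sum_pow_mul_eq_add_pow]

/-- The traces of the random set on two disjoint sets are independent. -/
lemma bernoulliSum_union [DecidableEq α] (p : ℝ) {A B : Finset α} (hAB : Disjoint A B)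
    {f g h : Finset α → ℝ} (hf : ∀ S ⊆ A, ∀ T ⊆ B, h (S ∪ T) = f S * g T) :
    bernoulliSum p (A ∪ B) h = bernoulliSum p A f * bernoulliSum p B g := by
  unfold bernoulliSum
  rw [sum_mul_sum, ← sum_product']
  symm
  refine sum_bij' (fun x _ => x.1 ∪ x.2) (fun T _ => (T ∩ A, T ∩ B)) ?_ ?_ ?_ ?_ ?_
  · rintro ⟨S, T⟩ h
    simp only [mem_product, mem_powerset] at h
    exact mem_powerset.2 (union_subset_union h.1 h.2)
  · intro T _
    simp
  · rintro ⟨S, T⟩ h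
    simp only [mem_product, mem_powerset] at h
    have h1 : T ∩ A = ∅ := disjoint_iff_inter_eq_empty.1 (hAB.symm.mono_left h.2)
    have h2 : S ∩ B = ∅ := disjoint_iff_inter_eq_empty.1 (hAB.mono_left h.1)
    simp [union_inter_distrib_right, h1, h2, inter_eq_left.2 h.1, inter_eq_left.2 h.2]
  · intro T hT
    rw [← inter_union_distrib_left, inter_eq_left.2 (mem_powerset.1 hT)]
  · rintro ⟨S, T⟩ h
    simp only [mem_product, mem_powerset] at h
    have h1 := card_le_card h.1
    have h2 := card_le_card h.2
    rw [card_union_of_disjoint hAB, card_union_of_disjoint (hAB.mono h.1 h.2), hf S h.1 T h.2,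
      show #A + #B - (#S + #T) = (#A - #S) + (#B - #T) by omega, pow_add, pow_add]
    ring

end Bernoulli

section Expectation

/-- The value `f G` is determined by which pairs in `D` are edges of `G`. -/
def DependsOnEdges {V β : Type*} (f : SimpleGraph V → β) (D : Finset (Sym2 V)) : Prop :=
  ∀ G H : SimpleGraph V, (∀ e ∈ D, e ∈ G.edgeSet ↔ e ∈ H.edgeSet) → f G = f H

lemma DependsOnEdges.comp {V β γ : Type*} {f : SimpleGraph V → β} {D : Finset (Sym2 V)}
    (hf : DependsOnEdges f D) (g : β → γ) : DependsOnEdges (fun G => g (f G)) D :=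
  fun G H h => congrArg g (hf G H h)

variable {V : Type*} [Fintype V] [DecidableEq V]

/-- The set of all potential edges, that is, of the unordered pairs of distinct vertices. -/
def edgePairs (V : Type*) [Fintype V] [DecidableEq V] : Finset (Sym2 V) :=
  univ.filter fun e => ¬ e.IsDiag

/-- The expectation of `f G` for the binomial random graph `G` on `V` with edge probability `p`. -/
noncomputable def expect (p : ℝ) (f : SimpleGraph V → ℝ) : ℝ :=
  bernoulliSum p (edgePairs V) fun T => f (SimpleGraph.fromEdgeSet (T : Set (Sym2 V)))

open scoped Classical in
/-- The probability that the binomial random graph on `V` with edge probability `p` has the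
property `P`. -/
noncomputable def prob (p : ℝ) (P : SimpleGraph V → Prop) : ℝ :=
  expect p fun G => if P G then 1 else 0

variable {p : ℝ} {f g : SimpleGraph V → ℝ} {P Q : SimpleGraph V → Prop}

lemma edgeSet_fromEdgeSet_of_subset {T : Finset (Sym2 V)} (hT : T ⊆ edgePairs V) :
    (SimpleGraph.fromEdgeSet (T : Set (Sym2 V))).edgeSet = T := by
  ext e
  rw [SimpleGraph.edgeSet_fromEdgeSet]
  simp only [Set.mem_sdiff, mem_coe]
  refine ⟨fun h => h.1, fun h => ⟨h, ?_⟩⟩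
  simpa using (mem_filter.1 (hT h)).2

lemma expect_add : expect p (fun G => f G + g G) = expect p f + expect p g := by
  simp [expect, bernoulliSum, mul_add, sum_add_distrib]

lemma expect_const_mul (c : ℝ) : expect p (fun G => c * f G) = c * expect p f := by
  simp only [expect, bernoulliSum, mul_sum]
  exact sum_congr rfl fun _ _ => by ring

lemma expect_sum {ι : Type*} (s : Finset ι) (F : ι → SimpleGraph V → ℝ) :
    expect p (fun G => ∑ i ∈ s, F i G) = ∑ i ∈ s, expect p (F i) := by
  simp only [expect, bernoulliSum, mul_sum]
  exact sum_comm

lemma expect_one : expect p (fun _ : SimpleGraph V => 1) = 1 := bernoulliSum_one _ _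

lemma expect_mono (h0 : 0 ≤ p) (h1 : p ≤ 1) (h : ∀ G, f G ≤ g G) : expect p f ≤ expect p g :=
  sum_le_sum fun _ _ => mul_le_mul_of_nonneg_left (h _)
    (mul_nonneg (pow_nonneg h0 _) (pow_nonneg (sub_nonneg.2 h1) _))

lemma expect_ite [DecidablePred P] :
    expect p (fun G => if P G then (1 : ℝ) else 0) = prob p P := by
  unfold prob
  congr! 3

lemma prob_mono (h0 : 0 ≤ p) (h1 : p ≤ 1) (h : ∀ G, P G → Q G) : prob p P ≤ prob p Q :=
  expect_mono h0 h1 fun G => by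
    by_cases hP : P G
    · simp [hP, h G hP]
    · simp only [hP, if_false]; split_ifs <;> norm_num

lemma prob_nonneg (h0 : 0 ≤ p) (h1 : p ≤ 1) : 0 ≤ prob p P := by
  classical
  have := expect_mono (V := V) (f := fun _ => (0 : ℝ) * 1)
    (g := fun G => if P G then 1 else 0) h0 h1
    fun G => by split_ifs <;> norm_num
  rw [expect_const_mul, zero_mul] at this
  exact this

/-- A random variable determined by the edges in `D` may be averaged over these edges only. -/
lemma expect_eq_bernoulliSum {D : Finset (Sym2 V)} (hf : DependsOnEdges f D)
    (hD : D ⊆ edgePairs V) :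
    expect p f = bernoulliSum p D fun T => f (SimpleGraph.fromEdgeSet (T : Set (Sym2 V))) := by
  unfold expect
  rw [← union_sdiff_of_subset hD]
  rw [bernoulliSum_union p disjoint_sdiff (g := fun _ => 1)
    (f := fun T => f (SimpleGraph.fromEdgeSet (T : Set (Sym2 V)))), bernoulliSum_one, mul_one]
  intro S hS T hT
  rw [mul_one]
  refine hf _ _ fun e he => ?_
  have heT : e ∉ T := fun h => (mem_sdiff.1 (hT h)).2 he
  simp [heT]

lemma expect_mul {D₁ D₂ : Finset (Sym2 V)} (hD : Disjoint D₁ D₂) (hf : DependsOnEdges f D₁)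
    (hg : DependsOnEdges g D₂) : expect p (fun G => f G * g G) = expect p f * expect p g := by
  have key : ∀ F : SimpleGraph V → ℝ, ∀ F₁ F₂ : SimpleGraph V → ℝ, DependsOnEdges F₁ D₁ →
      DependsOnEdges F₂ D₂ → (∀ G, F G = F₁ G * F₂ G) → expect p F =
      bernoulliSum p (edgePairs V ∩ D₁) (fun T => F₁ (.fromEdgeSet (T : Set (Sym2 V)))) *
      bernoulliSum p (edgePairs V \ D₁) (fun T => F₂ (.fromEdgeSet (T : Set (Sym2 V)))) := by
    intro F F₁ F₂ h1 h2 hF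
    unfold expect
    conv_lhs => rw [← sup_inf_sdiff (edgePairs V) D₁]
    refine bernoulliSum_union p (disjoint_sdiff.mono_left inter_subset_right) ?_
    intro S hS T hT
    rw [hF]
    congr 1
    · refine h1 _ _ fun e he => ?_
      have heT : e ∉ T := fun h => (mem_sdiff.1 (hT h)).2 he
      simp [heT]
    · refine h2 _ _ fun e he => ?_
      have heS : e ∉ S := fun h => disjoint_left.1 hD (mem_inter.1 (hS h)).2 he
      simp [heS]
  have hone : ∀ D : Finset (Sym2 V), DependsOnEdges (fun _ : SimpleGraph V => (1 : ℝ)) D :=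
    fun _ _ _ _ => rfl
  rw [key _ f g hf hg fun _ => rfl, key f f _ hf (hone _) fun _ => (mul_one _).symm,
    key g _ g (hone _) hg fun _ => (one_mul _).symm, bernoulliSum_one, bernoulliSum_one]
  ring

lemma prob_and {D₁ D₂ : Finset (Sym2 V)} (hD : Disjoint D₁ D₂) (hP : DependsOnEdges P D₁)
    (hQ : DependsOnEdges Q D₂) : prob p (fun G => P G ∧ Q G) = prob p P * prob p Q := by
  classical
  unfold prob
  rw [← expect_mul hD (hP.comp fun a => if a then (1 : ℝ) else 0)
    (hQ.comp fun a => if a then (1 : ℝ) else 0)]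
  congr 1
  ext G
  by_cases h1 : P G <;> by_cases h2 : Q G <;> simp [h1, h2]

lemma prob_congr (h : ∀ G, P G ↔ Q G) : prob p P = prob p Q := by
  rw [funext fun G => propext (h G)]

/-- The probability of prescribing all edges and non-edges in a given set of pairs. -/
lemma prob_edges_eq {I O : Finset (Sym2 V)} (hI : I ⊆ edgePairs V) (hO : O ⊆ edgePairs V)
    (hdisj : Disjoint I O) :
    prob p (fun G => (∀ e ∈ I, e ∈ G.edgeSet) ∧ ∀ e ∈ O, e ∉ G.edgeSet) =
      p ^ #I * (1 - p) ^ #O := by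
  classical
  unfold prob
  rw [expect_eq_bernoulliSum (D := I ∪ O) ?_ (union_subset hI hO)]
  · unfold bernoulliSum
    rw [sum_eq_single I]
    · beta_reduce
      rw [edgeSet_fromEdgeSet_of_subset hI, if_pos, card_union_of_disjoint hdisj]
      · simp
      · exact ⟨fun e he => he, fun e he h => disjoint_left.1 hdisj h he⟩
    · intro T hT hTI
      rw [mem_powerset] at hT
      beta_reduce
      rw [edgeSet_fromEdgeSet_of_subset (hT.trans (union_subset hI hO)), if_neg, mul_zero]
      rintro ⟨h1, h2⟩
      refine hTI (Subset.antisymm (fun e he => ?_) h1)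
      exact (mem_union.1 (hT he)).resolve_right fun h => h2 e h he
    · intro h
      exact absurd (mem_powerset.2 subset_union_left) h
  · refine DependsOnEdges.comp (f := fun G => (∀ e ∈ I, e ∈ G.edgeSet) ∧ ∀ e ∈ O, e ∉ G.edgeSet)
      (fun G H h => ?_) fun a => if a then (1 : ℝ) else 0
    refine propext (and_congr ?_ ?_)
    · exact forall₂_congr fun e he => h e (mem_union_left _ he)
    · exact forall₂_congr fun e he => not_congr (h e (mem_union_right _ he))

/-- The expectation as a sum over all graphs. -/
lemma expect_eq_sum_graph (p : ℝ) (f : SimpleGraph V → ℝ) :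
    expect p f = ∑ G : SimpleGraph V,
      p ^ G.edgeSet.ncard * (1 - p) ^ ((Fintype.card V).choose 2 - G.edgeSet.ncard) * f G := by
  classical
  unfold expect bernoulliSum
  refine sum_bij' (fun T _ => SimpleGraph.fromEdgeSet (T : Set (Sym2 V)))
    (fun G _ => G.edgeFinset) ?_ ?_ ?_ ?_ ?_
  · intro T _
    exact mem_univ _
  · intro G _
    rw [mem_powerset]
    intro e he
    exact mem_filter.2 ⟨mem_univ _, G.not_isDiag_of_mem_edgeFinset he⟩
  · intro T hT
    rw [mem_powerset] at hT
    rw [← coe_inj, SimpleGraph.coe_edgeFinset, edgeSet_fromEdgeSet_of_subset hT]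
  · intro G _
    simp
  · intro T hT
    rw [mem_powerset] at hT
    rw [edgeSet_fromEdgeSet_of_subset hT, Set.ncard_coe_finset, ← Sym2.card_subtype_not_diag,
      Fintype.card_subtype]
    rfl

lemma binomialRandom_eq_ofReal_prob (p : unitInterval) (P : SimpleGraph V → Prop) :
    SimpleGraph.binomialRandom V p {G | P G} = ENNReal.ofReal (prob (p : ℝ) P) := by
  classical
  have h0 := p.2.1
  have h1 := p.2.2
  have : MeasurableSingletonClass (SimpleGraph V) := ⟨fun G => by
    rw [← SimpleGraph.measurableEmbedding_edgeSet.measurableSet_image, Set.image_singleton]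
    exact MeasurableSet.singleton _⟩
  rw [prob, expect_eq_sum_graph, ENNReal.ofReal_sum_of_nonneg]
  · have hS : {G : SimpleGraph V | P G} = ((univ.filter P : Finset (SimpleGraph V)) : Set _) := by
      ext; simp
    rw [hS, ← MeasureTheory.sum_measure_singleton, sum_filter]
    refine sum_congr rfl fun G _ => ?_
    split_ifs with h
    · rw [SimpleGraph.binomialRandom_singleton, mul_one, ENNReal.ofReal_mul (by positivity),
        ENNReal.ofReal_pow h0, ENNReal.ofReal_pow (by linarith), Nat.card_eq_fintype_card]
      congr 2
      · rw [ENNReal.ofReal, Real.toNNReal_of_nonneg h0]; rfl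
      · rw [ENNReal.ofReal, Real.toNNReal_of_nonneg (by linarith)]; rfl
    · simp
  · intro G _
    have : 0 ≤ 1 - (p : ℝ) := by linarith
    positivity

/-- The random graph is invariant under relabelling of the vertices. -/
lemma prob_comap (p : ℝ) (P : SimpleGraph V → Prop) (σ : Equiv.Perm V) :
    prob p (fun G => P (G.comap σ)) = prob p P := by
  classical
  unfold prob
  rw [expect_eq_sum_graph, expect_eq_sum_graph]
  refine Fintype.sum_equiv σ.symm.simpleGraph _ _ fun G => ?_
  have hc : (σ.symm.simpleGraph G) = G.comap σ := rfl
  rw [hc]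
  have : (G.comap σ).edgeSet.ncard = G.edgeSet.ncard :=
    Set.ncard_congr' (SimpleGraph.Iso.mapEdgeSet (SimpleGraph.Iso.comap σ G))
  rw [this]

end Expectation

/-! ### Reachability inside a set of vertices and the susceptibility bound -/

section UnionBounds

variable {V ι : Type*} [Fintype V] [DecidableEq V] {p : ℝ} {P : SimpleGraph V → Prop}

lemma prob_of_forall (h : ∀ G, P G) : prob p P = 1 := by
  simp [prob, h, expect_one]

lemma prob_le_one (h0 : 0 ≤ p) (h1 : p ≤ 1) : prob p P ≤ 1 := by
  rw [← prob_of_forall (V := V) (p := p) (P := fun _ => True) fun _ => trivial]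
  exact prob_mono h0 h1 fun _ _ => trivial

lemma prob_le_sum (h0 : 0 ≤ p) (h1 : p ≤ 1) {s : Finset ι} {Q : ι → SimpleGraph V → Prop}
    (h : ∀ G, P G → ∃ i ∈ s, Q i G) : prob p P ≤ ∑ i ∈ s, prob p (Q i) := by
  classical
  unfold prob
  rw [← expect_sum]
  refine expect_mono h0 h1 fun G => ?_
  have hnn : ∀ i ∈ s, (0 : ℝ) ≤ if Q i G then 1 else 0 := fun i _ => by split_ifs <;> norm_num
  split_ifs with hP
  · obtain ⟨i, hi, hQ⟩ := h G hP
    refine le_trans ?_ (single_le_sum hnn hi)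
    simp [hQ]
  · exact sum_nonneg hnn

lemma sum_prob_le (h0 : 0 ≤ p) (h1 : p ≤ 1) {s : Finset ι} {Q : ι → SimpleGraph V → Prop}
    (h : ∀ G, ∀ i ∈ s, Q i G → P G)
    (hdisj : ∀ G, ∀ i ∈ s, ∀ j ∈ s, Q i G → Q j G → i = j) : ∑ i ∈ s, prob p (Q i) ≤ prob p P := by
  classical
  unfold prob
  rw [← expect_sum]
  refine expect_mono h0 h1 fun G => ?_
  rw [sum_boole]
  split_ifs with hP
  · norm_cast
    rw [card_le_one]
    intro i hi j hj
    rw [mem_filter] at hi hj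
    exact hdisj G i hi.1 j hj.1 hi.2 hj.2
  · rw [filter_eq_empty_iff.2 fun i hi hQ => hP (h G i hi hQ)]
    simp

end UnionBounds

section Reachability

/-- `y` can be reached from `x` by a walk in `G` all of whose vertices lie in `W`
(`x` is always reached from itself). -/
def ReachIn {V : Type*} (G : SimpleGraph V) (W : Finset V) : V → V → Prop :=
  Relation.ReflTransGen fun a b => G.Adj a b ∧ a ∈ W ∧ b ∈ W

/-- The pairs with one member in `A` and the other one in `B`. -/
def crossPairs {V : Type*} [DecidableEq V] (A B : Finset V) : Finset (Sym2 V) :=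
  (A ×ˢ B).image fun x => s(x.1, x.2)

/-- The vertices of `S` can be connected to each other within `S`. -/
def ConnIn {V : Type*} (G : SimpleGraph V) (S : Finset V) : Prop :=
  ∀ x ∈ S, ∀ y ∈ S, ReachIn G S x y

/-- `S` is the vertex set of a connected component of `G`. -/
def IsComp {V : Type*} [Fintype V] [DecidableEq V] (G : SimpleGraph V) (S : Finset V) : Prop :=
  S.Nonempty ∧ ConnIn G S ∧ ∀ e ∈ crossPairs S Sᶜ, e ∉ G.edgeSet

lemma ReachIn.mono {V : Type*} {G : SimpleGraph V} {W W' : Finset V} (h : W ⊆ W') {x y : V}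
    (hxy : ReachIn G W x y) : ReachIn G W' x y :=
  Relation.ReflTransGen.mono (fun _ _ hab => ⟨hab.1, h hab.2.1, h hab.2.2⟩) _ _ hxy

lemma ReachIn.symm {V : Type*} {G : SimpleGraph V} {W : Finset V} {x y : V}
    (hxy : ReachIn G W x y) : ReachIn G W y x := by
  induction hxy with
  | refl => exact .refl
  | tail _ h ih => exact .head ⟨h.1.symm, h.2.2, h.2.1⟩ ih

/-- First-step decomposition: a vertex reached from `v` is reached from a neighbour of `v` by a walk
avoiding `v`. -/
lemma ReachIn.exists_adj {V : Type*} [DecidableEq V] {G : SimpleGraph V} {W : Finset V} {v w : V}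
    (h : ReachIn G W v w) (hne : w ≠ v) :
    ∃ x ∈ W.erase v, G.Adj v x ∧ ReachIn G (W.erase v) x w := by
  induction h with
  | refl => exact absurd rfl hne
  | @tail y z _ hyz ih =>
    have hz : z ∈ W.erase v := mem_erase.2 ⟨hne, hyz.2.2⟩
    rcases eq_or_ne y v with rfl | hy
    · exact ⟨z, hz, hyz.1, .refl⟩
    · obtain ⟨x, hx, hvx, hxy⟩ := ih hy
      exact ⟨x, hx, hvx, hxy.tail ⟨hyz.1, mem_erase.2 ⟨hy, hyz.2.1⟩, hz⟩⟩

lemma dependsOnEdges_reachIn {V : Type*} {W : Finset V} [DecidableEq V] (x y : V) :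
    DependsOnEdges (fun G : SimpleGraph V => ReachIn G W x y) W.sym2 := by
  intro G H h
  have : (fun a b => G.Adj a b ∧ a ∈ W ∧ b ∈ W) = fun a b => H.Adj a b ∧ a ∈ W ∧ b ∈ W := by
    ext a b
    refine and_congr_left fun hab => ?_
    exact h s(a, b) (mk_mem_sym2_iff.2 hab)
  simp only [ReachIn, this]

lemma dependsOnEdges_connIn {V : Type*} {S : Finset V} [DecidableEq V] :
    DependsOnEdges (fun G : SimpleGraph V => ConnIn G S) S.sym2 := by
  intro G H h
  refine propext (forall₂_congr fun x _ => forall₂_congr fun y _ => ?_)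
  exact iff_of_eq (dependsOnEdges_reachIn x y G H h)

lemma mem_crossPairs {V : Type*} [DecidableEq V] {A B : Finset V} {x y : V} :
    s(x, y) ∈ crossPairs A B ↔ x ∈ A ∧ y ∈ B ∨ y ∈ A ∧ x ∈ B := by
  simp only [crossPairs, mem_image, mem_product, Prod.exists, Sym2.eq_iff]
  constructor
  · rintro ⟨a, b, ⟨ha, hb⟩, ⟨rfl, rfl⟩ | ⟨rfl, rfl⟩⟩ <;> tauto
  · rintro (h | h)
    · exact ⟨x, y, h, .inl ⟨rfl, rfl⟩⟩
    · exact ⟨y, x, h, .inr ⟨rfl, rfl⟩⟩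

lemma card_crossPairs {V : Type*} [DecidableEq V] {A B : Finset V} (h : Disjoint A B) :
    #(crossPairs A B) = #A * #B := by
  rw [crossPairs, card_image_of_injOn, card_product]
  rintro ⟨a, b⟩ hab ⟨c, d⟩ hcd hEq
  simp only [coe_product, Set.mem_prod, mem_coe] at hab hcd
  rcases Sym2.eq_iff.1 hEq with ⟨h1, h2⟩ | ⟨h1, h2⟩
  · exact Prod.ext h1 h2
  · exact absurd hab.1 fun h' => disjoint_left.1 h h' ((show a = d from h1) ▸ hcd.2)

variable {V : Type*} [Fintype V] [DecidableEq V] {A B S T : Finset V}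

lemma crossPairs_subset_edgePairs (h : Disjoint A B) : crossPairs A B ⊆ edgePairs V := by
  intro e he
  induction e with
  | h x y =>
    rw [edgePairs, mem_filter, Sym2.mk_isDiag_iff]
    refine ⟨mem_univ _, ?_⟩
    rintro rfl
    rw [mem_crossPairs] at he
    exact disjoint_left.1 h (by tauto) (by tauto : x ∈ B)

lemma IsComp.mem_of_adj {G : SimpleGraph V} (hS : IsComp G S) {x y : V} (hx : x ∈ S)
    (hxy : G.Adj x y) : y ∈ S := by
  by_contra hy
  exact hS.2.2 s(x, y) (mem_crossPairs.2 (.inl ⟨hx, mem_compl.2 hy⟩)) hxy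

lemma IsComp.subset {G : SimpleGraph V} (hS : IsComp G S) (hT : IsComp G T) {x : V} (hxS : x ∈ S)
    (hxT : x ∈ T) : S ⊆ T := by
  intro y hy
  have := hS.2.1 x hxS y hy
  clear hy
  induction this with
  | refl => exact hxT
  | tail _ h ih => exact hT.mem_of_adj ih h.1

lemma IsComp.eq_or_disjoint {G : SimpleGraph V} (hS : IsComp G S) (hT : IsComp G T) :
    S = T ∨ Disjoint S T := by
  by_cases h : Disjoint S T
  · exact .inr h
  · obtain ⟨x, hxS, hxT⟩ := not_disjoint_iff.1 h
    exact .inl ((hS.subset hT hxS hxT).antisymm (hT.subset hS hxT hxS))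

variable {p : ℝ}

/-- The expected size of the component of a vertex is at most `1 / (1 - np)`. -/
lemma sum_prob_reachIn_le (h0 : 0 ≤ p) (hnp : Fintype.card V * p < 1) (W : Finset V) (v : V) :
    ∑ w ∈ W, prob p (fun G => ReachIn G W v w) ≤ 1 / (1 - Fintype.card V * p) := by
  have hcard : (1 : ℝ) ≤ Fintype.card V := by
    exact_mod_cast Fintype.card_pos_iff.2 ⟨v⟩
  have h1 : p ≤ 1 := by nlinarith
  have hpos : 0 < 1 - Fintype.card V * p := by linarith
  induction hk : #W generalizing W v with
  | zero =>
    rw [card_eq_zero.1 hk, sum_empty]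
    positivity
  | succ k ih =>
    by_cases hv : v ∈ W
    swap
    · refine le_trans (le_of_eq (sum_eq_zero fun w hw => ?_)) (by positivity)
      refine le_antisymm ?_ (prob_nonneg h0 h1)
      refine (prob_le_sum (ι := ℕ) (s := ∅) h0 h1 (Q := fun _ _ => True) fun G hG => ?_).trans_eq
        sum_empty
      rcases Relation.ReflTransGen.cases_head hG with rfl | ⟨x, hx, _⟩
      · exact absurd hw hv
      · exact absurd hx.2.1 hv
    have hkW : #(W.erase v) = k := by rw [card_erase_of_mem hv, hk]; rfl
    rw [← add_sum_erase W _ hv]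
    have hstep : ∀ w ∈ W.erase v, prob p (fun G => ReachIn G W v w) ≤
        ∑ x ∈ W.erase v, p * prob p (fun G => ReachIn G (W.erase v) x w) := by
      intro w hw
      refine (prob_le_sum h0 h1 (s := W.erase v)
        (Q := fun x G => G.Adj v x ∧ ReachIn G (W.erase v) x w)
        fun G hG => hG.exists_adj (ne_of_mem_erase hw)).trans_eq ?_
      refine sum_congr rfl fun x hx => ?_
      rw [prob_and (D₁ := {s(v, x)}) (D₂ := (W.erase v).sym2)]
      · congr 1
        have := prob_edges_eq (V := V) (p := p) (I := {s(v, x)}) (O := ∅)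
          (by simpa [edgePairs] using (ne_of_mem_erase hx).symm) (empty_subset _)
          (disjoint_empty_right _)
        simpa using this
      · rw [disjoint_singleton_left, mk_mem_sym2_iff]
        simp
      · intro G H h
        exact propext (h s(v, x) (mem_singleton_self _))
      · exact dependsOnEdges_reachIn x w
    calc _ ≤ 1 + ∑ w ∈ W.erase v, ∑ x ∈ W.erase v,
          p * prob p (fun G => ReachIn G (W.erase v) x w) :=
          add_le_add (prob_le_one h0 h1) (sum_le_sum hstep)
      _ = 1 + ∑ x ∈ W.erase v, p * ∑ w ∈ W.erase v,
          prob p (fun G => ReachIn G (W.erase v) x w) := by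
          rw [sum_comm]; simp only [mul_sum]
      _ ≤ 1 + ∑ x ∈ W.erase v, p * (1 / (1 - Fintype.card V * p)) := by
          gcongr with x hx
          exact ih _ x hkW
      _ ≤ 1 + Fintype.card V * (p * (1 / (1 - Fintype.card V * p))) := by
          rw [sum_const, nsmul_eq_mul]
          gcongr
          exact card_le_univ _
      _ = 1 / (1 - Fintype.card V * p) := by
          field_simp
          ring

end Reachability

/-! ### Probability that a set of vertices is connected, or a component -/

section ComponentProbability

/-- The identity behind the recursion for rooted forests, used with `x = b + #U`. -/
lemma sum_powerset_add_card_mul_pow {V : Type*} [DecidableEq V] (U : Finset V) (b x : ℝ) :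
    (1 + x) * ∑ N ∈ U.powerset, (b + #N) * x ^ (#U - #N) =
      (1 + x) ^ #U * (b * (1 + x) + #U) := by
  induction U using Finset.induction_on generalizing b with
  | empty => simp; ring
  | insert v U hv ih =>
    rw [sum_powerset_insert hv, card_insert_of_notMem hv]
    have h1 : ∑ N ∈ U.powerset, (b + #N) * x ^ (#U + 1 - #N) =
        x * ∑ N ∈ U.powerset, (b + #N) * x ^ (#U - #N) := by
      rw [mul_sum]
      refine sum_congr rfl fun N hN => ?_
      rw [Nat.sub_add_comm (card_le_card (mem_powerset.1 hN)), pow_succ]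
      ring
    have h2 : ∑ N ∈ U.powerset, (b + #(insert v N)) * x ^ (#U + 1 - #(insert v N)) =
        ∑ N ∈ U.powerset, ((b + 1) + #N) * x ^ (#U - #N) := by
      refine sum_congr rfl fun N hN => ?_
      rw [card_insert_of_notMem fun h => hv (mem_powerset.1 hN h), Nat.add_sub_add_right]
      push_cast
      ring
    rw [h1, h2, mul_add, ih, mul_left_comm, ih]
    push_cast
    ring

variable {V : Type*} [Fintype V] [DecidableEq V] {S T : Finset V} {p : ℝ}

/-- Every vertex of `U` can be reached from `A` within `A ∪ U`. -/
def ReachedFrom (G : SimpleGraph V) (A U : Finset V) : Prop :=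
  ∀ u ∈ U, ∃ a ∈ A, ReachIn G (A ∪ U) a u

/-- The exponents of `1 - p` in `le_prob_reachedFrom` are consistent: `m` non-edges at the explored
vertex, and the exponent for the `a + i` active and `m` unreached vertices that remain, add up to at
most the exponent for the `a + 1` active and `i + m` unreached vertices before the step. -/
lemma card_pairs_step (a i m : ℕ) :
    m + ((a + i) * m + m.choose 2) ≤ (a + 1) * (i + m) + (i + m).choose 2 := by
  have h : (i + m).choose 2 = i.choose 2 + m.choose 2 + i * m := by
    induction m with
    | zero => simp
    | succ m ih =>
      rw [← add_assoc, Nat.choose_succ_succ' (i + m) 1, ih, Nat.choose_succ_succ' m 1,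
        Nat.choose_one_right, Nat.choose_one_right]
      ring
  rw [h]
  nlinarith [Nat.zero_le (i.choose 2), Nat.zero_le (a * i)]

/-- A lower bound for the probability that `A` reaches all of `U`, found by exploring the vertices
one at a time. The factor `a (a + u) ^ (u - 1)` is the number of forests on `A ∪ U` rooted at
`A`. -/
lemma le_prob_reachedFrom (h0 : 0 ≤ p) (h1 : p ≤ 1) {A U : Finset V} (hAU : Disjoint A U) :
    #A * (#A + #U : ℝ) ^ #U * p ^ #U * (1 - p) ^ (#A * #U + (#U).choose 2) ≤
      (#A + #U) * prob p fun G => ReachedFrom G A U := by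
  have hq : 0 ≤ 1 - p := by linarith
  have hq1 : 1 - p ≤ 1 := by linarith
  induction hk : #A + #U generalizing A U with
  | zero =>
    rw [show #A = 0 by omega, show #U = 0 by omega]
    simp
  | succ k ih =>
    rcases A.eq_empty_or_nonempty with rfl | ⟨a₀, ha₀⟩
    · simp only [card_empty, Nat.cast_zero, zero_mul, zero_add]
      exact mul_nonneg (Nat.cast_nonneg _) (prob_nonneg h0 h1)
    rcases U.eq_empty_or_nonempty with rfl | hU
    · rw [prob_of_forall (P := fun G => ReachedFrom G A ∅) fun G u hu => absurd hu (notMem_empty u)]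
      simp
    obtain ⟨a, ha⟩ : ∃ a, #A = a + 1 := ⟨#A - 1, by have := card_pos.2 ⟨a₀, ha₀⟩; omega⟩
    have hUpos := card_pos.2 hU
    have haU : a₀ ∉ U := fun h => disjoint_left.1 hAU ha₀ h
    -- Condition on the set `N` of neighbours of `a₀` in `U`.
    have hkey : ∑ N ∈ U.powerset, p ^ #N * (1 - p) ^ #(U \ N) *
        prob p (fun G => ReachedFrom G (A.erase a₀ ∪ N) (U \ N)) ≤
        prob p fun G => ReachedFrom G A U := by
      have hset : ∀ N ⊆ U, (A.erase a₀ ∪ N) ∪ (U \ N) = (A ∪ U).erase a₀ := by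
        intro N hN
        rw [union_assoc, union_sdiff_of_subset hN, erase_union_distrib, erase_eq_of_notMem haU]
      have hrw : ∀ N ∈ U.powerset, p ^ #N * (1 - p) ^ #(U \ N) *
          prob p (fun G => ReachedFrom G (A.erase a₀ ∪ N) (U \ N)) =
          prob p fun G => ((∀ e ∈ crossPairs {a₀} N, e ∈ G.edgeSet) ∧
            ∀ e ∈ crossPairs {a₀} (U \ N), e ∉ G.edgeSet) ∧
            ReachedFrom G (A.erase a₀ ∪ N) (U \ N) := by
        intro N hN
        rw [mem_powerset] at hN
        have hd1 : Disjoint {a₀} N := disjoint_singleton_left.2 fun h => haU (hN h)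
        have hd2 : Disjoint {a₀} (U \ N) :=
          disjoint_singleton_left.2 fun h => haU (sdiff_subset h)
        rw [prob_and (D₁ := crossPairs {a₀} U) (D₂ := ((A ∪ U).erase a₀).sym2),
          prob_edges_eq (crossPairs_subset_edgePairs hd1) (crossPairs_subset_edgePairs hd2),
          card_crossPairs hd1, card_crossPairs hd2, card_singleton, one_mul, one_mul]
        · rw [disjoint_left]
          intro e
          induction e with
          | h x y =>
            rw [mem_crossPairs, mem_crossPairs]
            simp only [mem_singleton, Finset.mem_sdiff]
            rintro (⟨rfl, hy⟩ | ⟨rfl, hx⟩) (⟨h, h'⟩ | ⟨h, h'⟩) <;> simp_all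
        · rw [disjoint_left]
          intro e
          induction e with
          | h x y =>
            rw [mem_crossPairs, mk_mem_sym2_iff]
            simp only [mem_singleton, mem_erase]
            tauto
        · intro G H h
          have hmem : ∀ N' ⊆ U, crossPairs {a₀} N' ⊆ crossPairs {a₀} U := fun N' hN' =>
            image_subset_image (product_subset_product_right hN')
          exact propext (and_congr (forall₂_congr fun e he => h e (hmem N hN he))
            (forall₂_congr fun e he => not_congr (h e (hmem _ sdiff_subset he))))
        · intro G H h
          refine propext (forall₂_congr fun u _ => exists_congr fun b =>
            and_congr_right fun _ => ?_)
          rw [hset N hN]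
          exact iff_of_eq (dependsOnEdges_reachIn b u G H h)
      rw [sum_congr rfl hrw]
      refine sum_prob_le h0 h1 ?_ ?_
      · rintro G N hN ⟨⟨hin, -⟩, hR⟩ y hy
        rw [mem_powerset] at hN
        have hadj : ∀ x ∈ N, G.Adj a₀ x := fun x hx =>
          hin s(a₀, x) (mem_crossPairs.2 (.inl ⟨mem_singleton_self _, hx⟩))
        have hsub : (A.erase a₀ ∪ N) ∪ (U \ N) ⊆ A ∪ U := by
          rw [hset N hN]; exact erase_subset _ _
        have hmemA : a₀ ∈ A ∪ U := mem_union_left _ ha₀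
        by_cases hyN : y ∈ N
        · exact ⟨a₀, ha₀, .single ⟨hadj y hyN, hmemA, mem_union_right _ hy⟩⟩
        · obtain ⟨b, hb, hby⟩ := hR y (Finset.mem_sdiff.2 ⟨hy, hyN⟩)
          rcases mem_union.1 hb with hb | hb
          · exact ⟨b, mem_of_mem_erase hb, hby.mono hsub⟩
          · exact ⟨a₀, ha₀, .head ⟨hadj b hb, hmemA, mem_union_right _ (hN hb)⟩ (hby.mono hsub)⟩
      · have hle : ∀ G : SimpleGraph V, ∀ N ⊆ U, ∀ N', (∀ e ∈ crossPairs {a₀} N, e ∈ G.edgeSet) →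
            (∀ e ∈ crossPairs {a₀} (U \ N'), e ∉ G.edgeSet) → N ⊆ N' := by
          intro G N hN N' hin hout x hx
          by_contra hx'
          exact hout s(a₀, x) (mem_crossPairs.2 (.inl ⟨mem_singleton_self _,
            Finset.mem_sdiff.2 ⟨hN hx, hx'⟩⟩))
            (hin _ (mem_crossPairs.2 (.inl ⟨mem_singleton_self _, hx⟩)))
        intro G N hN N' hN' h h'
        rw [mem_powerset] at hN hN'
        exact (hle G N hN N' h.1.1 h'.1.2).antisymm (hle G N' hN' N h'.1.1 h.1.2)
    -- The case `#A + #U = k` of the bound, for the state after exploring `a₀`.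
    have hterm : ∀ N ∈ U.powerset,
        p ^ #U * (1 - p) ^ (#A * #U + (#U).choose 2) * ((a + #N) * (k : ℝ) ^ (#U - #N)) ≤
        k * (p ^ #N * (1 - p) ^ #(U \ N) *
          prob p (fun G => ReachedFrom G (A.erase a₀ ∪ N) (U \ N))) := by
      intro N hN
      rw [mem_powerset] at hN
      have hcN := card_le_card hN
      have hdis : Disjoint (A.erase a₀) N :=
        (hAU.mono_right hN).mono_left (erase_subset _ _)
      have hcA : #(A.erase a₀ ∪ N) = a + #N := by
        rw [card_union_of_disjoint hdis, card_erase_of_mem ha₀, ha]; rfl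
      have hcU : #(U \ N) = #U - #N := card_sdiff_of_subset hN
      have hdis' : Disjoint (A.erase a₀ ∪ N) (U \ N) :=
        disjoint_union_left.2 ⟨hAU.mono (erase_subset _ _) sdiff_subset, disjoint_sdiff⟩
      have hsum : a + #N + (#U - #N) = k := by omega
      have hI := ih hdis' (by rw [hcA, hcU, hsum])
      rw [hcA, hcU] at hI
      have hcast : ((a + #N : ℕ) : ℝ) + ((#U - #N : ℕ) : ℝ) = k := by exact_mod_cast hsum
      rw [hcast] at hI
      have hexp := card_pairs_step a #N (#U - #N)
      rw [Nat.add_sub_cancel' hcN, ← ha] at hexp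
      rw [hcU]
      calc _ = (p ^ #N * p ^ (#U - #N)) * (1 - p) ^ (#A * #U + (#U).choose 2) *
            ((a + #N) * (k : ℝ) ^ (#U - #N)) := by
            rw [← pow_add, Nat.add_sub_cancel' hcN]
        _ ≤ (p ^ #N * p ^ (#U - #N)) *
            (1 - p) ^ (#U - #N + ((a + #N) * (#U - #N) + (#U - #N).choose 2)) *
            ((a + #N) * (k : ℝ) ^ (#U - #N)) := by
            gcongr ?_ * ?_ * ?_
            exact pow_le_pow_of_le_one hq hq1 hexp
        _ = p ^ #N * (1 - p) ^ (#U - #N) * (((a + #N : ℕ) : ℝ) * (k : ℝ) ^ (#U - #N) *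
            p ^ (#U - #N) * (1 - p) ^ ((a + #N) * (#U - #N) + (#U - #N).choose 2)) := by
            rw [pow_add (1 - p)]
            push_cast
            ring
        _ ≤ p ^ #N * (1 - p) ^ (#U - #N) *
            (k * prob p (fun G => ReachedFrom G (A.erase a₀ ∪ N) (U \ N))) := by
            gcongr
        _ = _ := by ring
    have hkpos : (0 : ℝ) < k := by
      have : 0 < k := by omega
      exact_mod_cast this
    have hsumle := sum_le_sum hterm
    rw [← mul_sum, ← mul_sum] at hsumle
    have hid := sum_powerset_add_card_mul_pow U (a : ℝ) (k : ℝ)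
    have hkU : (a : ℝ) * (1 + k) + #U = k * (a + 1) := by
      have : (k : ℝ) = a + #U := by
        have : k = a + #U := by omega
        exact_mod_cast this
      rw [this]; ring
    rw [hkU] at hid
    have hAc : (#A : ℝ) = a + 1 := by rw [ha]; push_cast; ring
    have hN : (#A : ℝ) + #U = 1 + k := by
      have : #A + #U = 1 + k := by omega
      exact_mod_cast this
    rw [hN]
    refine le_of_mul_le_mul_left ?_ hkpos
    calc _ = p ^ #U * (1 - p) ^ (#A * #U + (#U).choose 2) *
          ((1 + (k : ℝ)) ^ #U * (k * (a + 1))) := by rw [hAc]; ring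
      _ = (1 + k) * (p ^ #U * (1 - p) ^ (#A * #U + (#U).choose 2) *
          ∑ N ∈ U.powerset, (a + #N) * (k : ℝ) ^ (#U - #N)) := by rw [← hid]; ring
      _ ≤ (1 + k) * (k * prob p fun G => ReachedFrom G A U) := by
          refine mul_le_mul_of_nonneg_left (hsumle.trans ?_) (by positivity)
          exact mul_le_mul_of_nonneg_left hkey hkpos.le
      _ = _ := by ring

/-- The lower bound with `j ^ (j - 2)`, the number of spanning trees, on the probability that a set
of `j` vertices is connected. -/
lemma le_prob_connIn (h0 : 0 ≤ p) (h1 : p ≤ 1) (hS : S.Nonempty) :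
    (#S : ℝ) ^ (#S - 1) * p ^ (#S - 1) * (1 - p) ^ (#S).choose 2 ≤
      #S * prob p fun G => ConnIn G S := by
  obtain ⟨x, hx⟩ := hS
  have h := le_prob_reachedFrom h0 h1 (A := {x}) (U := S.erase x) (by simp)
  obtain ⟨m, hm⟩ : ∃ m, #S = m + 1 := ⟨#S - 1, by have := card_pos.2 ⟨x, hx⟩; omega⟩
  have hc : #(S.erase x) = m := by rw [card_erase_of_mem hx, hm]; rfl
  have hu : {x} ∪ S.erase x = S := by
    rw [← insert_eq, insert_erase hx]
  have hch : (m + 1).choose 2 = 1 * m + m.choose 2 := by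
    rw [Nat.choose_succ_succ' m 1, Nat.choose_one_right, one_mul]
  rw [hc, card_singleton, ← hch] at h
  rw [hm, Nat.add_sub_cancel]
  push_cast at h ⊢
  rw [one_mul, add_comm (1 : ℝ)] at h
  refine h.trans (mul_le_mul_of_nonneg_left (prob_mono h0 h1 fun G hG => ?_) (by positivity))
  have hxr : ∀ y ∈ S, ReachIn G S x y := by
    intro y hy
    rcases eq_or_ne y x with rfl | hne
    · exact .refl
    · obtain ⟨a, ha, hay⟩ := hG y (mem_erase.2 ⟨hne, hy⟩)
      rw [mem_singleton.1 ha, hu] at hay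
      exact hay
  exact fun y hy z hz => (hxr y hy).symm.trans (hxr z hz)

lemma prob_no_edges {D : Finset (Sym2 V)} (hD : D ⊆ edgePairs V) :
    prob p (fun G => ∀ e ∈ D, e ∉ G.edgeSet) = (1 - p) ^ #D := by
  have := prob_edges_eq (p := p) (empty_subset (edgePairs V)) hD (disjoint_empty_left _)
  simpa using this

lemma dependsOnEdges_no_edges {V : Type*} (D : Finset (Sym2 V)) :
    DependsOnEdges (fun G : SimpleGraph V => ∀ e ∈ D, e ∉ G.edgeSet) D :=
  fun _ _ h => propext (forall₂_congr fun e he => not_congr (h e he))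

lemma disjoint_sym2_crossPairs {V : Type*} [DecidableEq V] {S T U : Finset V}
    (h : Disjoint U S ∨ Disjoint U T) :
    Disjoint U.sym2 (crossPairs S T) := by
  rw [disjoint_left]
  intro e
  induction e with
  | h x y =>
    rw [mem_crossPairs, mk_mem_sym2_iff]
    rcases h with h | h <;> rw [disjoint_left] at h <;> rintro ⟨hx, hy⟩ (⟨h1, h2⟩ | ⟨h1, h2⟩)
    · exact h hx h1
    · exact h hy h1
    · exact h hy h2
    · exact h hx h2

lemma prob_isComp (hS : S.Nonempty) :
    prob p (fun G => IsComp G S) =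
      prob p (fun G => ConnIn G S) * (1 - p) ^ (#S * (Fintype.card V - #S)) := by
  rw [← card_compl, ← card_crossPairs disjoint_compl_right,
    ← prob_no_edges (crossPairs_subset_edgePairs disjoint_compl_right),
    ← prob_and (disjoint_sym2_crossPairs (.inr disjoint_compl_right)) dependsOnEdges_connIn
      (dependsOnEdges_no_edges _)]
  exact prob_congr fun G => ⟨fun h => h.2, fun h => ⟨hS, h⟩⟩

/-- The pairs between two disjoint sets are forced non-edges for both of them. Counted only once,
they make it more likely that both sets are components, by at most the inverse of the factor on
the left. -/
lemma prob_isComp_and_isComp_le (h0 : 0 ≤ p) (h1 : p ≤ 1) (hS : S.Nonempty) (hT : T.Nonempty)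
    (hST : Disjoint S T) :
    (1 - p) ^ (#S * #T) * prob p (fun G => IsComp G S ∧ IsComp G T) ≤
      prob p (fun G => IsComp G S) * prob p (fun G => IsComp G T) := by
  have hq : 0 ≤ 1 - p := by linarith
  set X := crossPairs S Sᶜ
  set Y := crossPairs T Tᶜ
  have hX : X ⊆ edgePairs V := crossPairs_subset_edgePairs disjoint_compl_right
  have hY : Y ⊆ edgePairs V := crossPairs_subset_edgePairs disjoint_compl_right
  have hSX : Disjoint S.sym2 X := disjoint_sym2_crossPairs (.inr disjoint_compl_right)
  have hTY : Disjoint T.sym2 Y := disjoint_sym2_crossPairs (.inr disjoint_compl_right)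
  have hSY : Disjoint S.sym2 Y := disjoint_sym2_crossPairs (.inl hST)
  have hTX : Disjoint T.sym2 X := disjoint_sym2_crossPairs (.inl hST.symm)
  have hSS : Disjoint S.sym2 T.sym2 := by
    rw [disjoint_left]
    intro e
    induction e with
    | h x y =>
      rw [mk_mem_sym2_iff, mk_mem_sym2_iff]
      exact fun h h' => disjoint_left.1 hST h.1 h'.1
  have hboth : prob p (fun G => IsComp G S ∧ IsComp G T) =
      prob p (fun G => ConnIn G S) * (prob p (fun G => ConnIn G T) * (1 - p) ^ #(X ∪ Y)) := by
    rw [← prob_no_edges (union_subset hX hY),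
      ← prob_and (D₁ := T.sym2) (D₂ := X ∪ Y) (disjoint_union_right.2 ⟨hTX, hTY⟩)
        dependsOnEdges_connIn (dependsOnEdges_no_edges _),
      ← prob_and (D₁ := S.sym2) (D₂ := T.sym2 ∪ (X ∪ Y))
        (disjoint_union_right.2 ⟨hSS, disjoint_union_right.2 ⟨hSX, hSY⟩⟩) dependsOnEdges_connIn]
    · refine prob_congr fun G => ⟨fun h => ⟨h.1.2.1, h.2.2.1, fun e he => ?_⟩, fun h =>
        ⟨⟨hS, h.1, fun e he => h.2.2 e (mem_union_left _ he)⟩,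
          hT, h.2.1, fun e he => h.2.2 e (mem_union_right _ he)⟩⟩
      exact (mem_union.1 he).elim (h.1.2.2 e) (h.2.2.2 e)
    · intro G H h
      refine propext (and_congr (iff_of_eq (dependsOnEdges_connIn G H fun e he => ?_))
        (iff_of_eq (dependsOnEdges_no_edges _ G H fun e he => ?_)))
      · exact h e (mem_union_left _ he)
      · exact h e (mem_union_right _ he)
  have hXY : #(X ∩ Y) ≤ #S * #T := by
    rw [← card_crossPairs hST]
    refine card_le_card fun e => ?_
    induction e with
    | h x y =>
      rw [mem_inter, mem_crossPairs, mem_crossPairs, mem_crossPairs]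
      simp only [mem_compl]
      have := @disjoint_left _ S T |>.1 hST
      tauto
  have hcard : #X + #Y ≤ #S * #T + #(X ∪ Y) := by
    rw [← card_union_add_card_inter]; omega
  rw [hboth, prob_isComp hS, prob_isComp hT, ← card_compl, ← card_compl,
    ← card_crossPairs (disjoint_compl_right (a := S)),
    ← card_crossPairs (disjoint_compl_right (a := T))]
  have hc1 := prob_nonneg (P := fun G => ConnIn G S) h0 h1
  have hc2 := prob_nonneg (P := fun G => ConnIn G T) h0 h1
  calc _ = prob p (fun G => ConnIn G S) * prob p (fun G => ConnIn G T) *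
        (1 - p) ^ (#S * #T + #(X ∪ Y)) := by rw [pow_add]; ring
    _ ≤ prob p (fun G => ConnIn G S) * prob p (fun G => ConnIn G T) * (1 - p) ^ (#X + #Y) := by
        refine mul_le_mul_of_nonneg_left ?_ (mul_nonneg hc1 hc2)
        exact pow_le_pow_of_le_one hq (by linarith) hcard
    _ = _ := by rw [pow_add]; ring

end ComponentProbability

/-! ### Change of the edge probability, and the second moment -/

section Tilting

variable {V : Type*} [Fintype V] [DecidableEq V] {S : Finset V} {p p' : ℝ}

/-- Connecting `S` takes at least `#S - 1` edges. -/
lemma card_le_of_connIn {V : Type*} {S : Finset V} {T : Finset (Sym2 V)} (hS : S.Nonempty)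
    (h : ConnIn (SimpleGraph.fromEdgeSet (T : Set (Sym2 V))) S) : #S ≤ #T + 1 := by
  set G := SimpleGraph.fromEdgeSet (T : Set (Sym2 V))
  have : Nonempty (S : Set V) := hS.to_subtype
  have hreach : ∀ x y, (hx : x ∈ S) → ReachIn G S x y → ∃ hy : y ∈ S,
      (G.induce (S : Set V)).Reachable ⟨x, hx⟩ ⟨y, hy⟩ := by
    intro x y hx hxy
    induction hxy with
    | refl => exact ⟨hx, .refl _⟩
    | @tail y z _ hyz ih =>
      obtain ⟨hy, hr⟩ := ih
      refine ⟨hyz.2.2, hr.trans (SimpleGraph.Adj.reachable ?_)⟩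
      exact hyz.1
  have hconn : (G.induce (S : Set V)).Connected :=
    ⟨fun x y => (hreach x y x.2 (h x x.2 y y.2)).2⟩
  have hcard := hconn.card_vert_le_card_edgeSet_add_one
  have hle : Nat.card (G.induce (S : Set V)).edgeSet ≤ #T := by
    rw [← Nat.card_eq_finsetCard T]
    refine Nat.card_le_card_of_injective
      (fun e => (⟨Sym2.map Subtype.val e.1, ?_⟩ : T)) ?_
    · obtain ⟨e, he⟩ := e
      induction e with
      | h x y =>
        exact ((SimpleGraph.fromEdgeSet_adj _).1 (show G.Adj x y from he)).1
    · intro e e' hee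
      exact Subtype.ext (Sym2.map.injective Subtype.val_injective (congrArg Subtype.val hee))
  have : Nat.card (S : Set V) = #S := by simp
  omega

/-- Whether `S` is a component is determined by the pairs that meet `S`. -/
lemma dependsOnEdges_isComp :
    DependsOnEdges (fun G : SimpleGraph V => IsComp G S) (crossPairs S univ ∩ edgePairs V) := by
  intro G H h
  have hadj : ∀ x ∈ S, ∀ y, G.Adj x y ↔ H.Adj x y := by
    intro x hx y
    rcases eq_or_ne x y with rfl | hne
    · simp
    · refine h s(x, y) (mem_inter.2 ⟨mem_crossPairs.2 (.inl ⟨hx, mem_univ _⟩), ?_⟩)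
      simpa [edgePairs] using hne
  have hfun : (fun a b => G.Adj a b ∧ a ∈ S ∧ b ∈ S) = fun a b => H.Adj a b ∧ a ∈ S ∧ b ∈ S := by
    ext a b
    exact and_congr_left fun hab => hadj a hab.1 b
  refine propext (and_congr_right fun _ => and_congr ?_ (forall₂_congr fun e he => ?_))
  · simp only [ConnIn, ReachIn, hfun]
  · induction e with
    | h x y =>
      rw [mem_crossPairs] at he
      rw [SimpleGraph.mem_edgeSet, SimpleGraph.mem_edgeSet]
      rcases he with he | he
      · exact not_congr (hadj x he.1 y)
      · rw [G.adj_comm, H.adj_comm]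
        exact not_congr (hadj y he.1 x)

/-- Comparison of two edge probabilities `p ≤ p'`: a component on `j` vertices uses at least
`j - 1` edges, and it is determined by at most `j n` pairs. -/
lemma prob_isComp_le_mul (h0 : 0 < p) (hpp : p ≤ p') (h1 : p' < 1) :
    prob p (fun G => IsComp G S) ≤
      (p / p') ^ (#S - 1) * ((1 - p) / (1 - p')) ^ (#S * Fintype.card V) *
        prob p' fun G => IsComp G S := by
  classical
  have h0' : 0 < p' := h0.trans_le hpp
  have hq' : 0 < 1 - p' := by linarith
  have hq : 0 < 1 - p := by linarith
  unfold prob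
  have hdep := (dependsOnEdges_isComp (S := S)).comp fun a => if a then (1 : ℝ) else 0
  rw [expect_eq_bernoulliSum hdep inter_subset_right,
    expect_eq_bernoulliSum hdep inter_subset_right]
  set D := crossPairs S univ ∩ edgePairs V
  have hD : #D ≤ #S * Fintype.card V :=
    (card_le_card inter_subset_left).trans (card_image_le.trans (by rw [card_product]; rfl))
  unfold bernoulliSum
  rw [mul_sum]
  refine sum_le_sum fun T hT => ?_
  beta_reduce
  split_ifs with hc
  swap
  · simp
  have hcard := card_le_of_connIn hc.1 hc.2.1
  rw [mul_one, mul_one]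
  have e1 : (p / p') ^ #T ≤ (p / p') ^ (#S - 1) :=
    pow_le_pow_of_le_one (by positivity) ((div_le_one h0').2 hpp) (by omega)
  have e2 : ((1 - p) / (1 - p')) ^ (#D - #T) ≤
      ((1 - p) / (1 - p')) ^ (#S * Fintype.card V) :=
    pow_le_pow_right₀ ((one_le_div hq').2 (by linarith)) (by omega)
  calc p ^ #T * (1 - p) ^ (#D - #T)
      = (p / p') ^ #T * ((1 - p) / (1 - p')) ^ (#D - #T) *
        (p' ^ #T * (1 - p') ^ (#D - #T)) := by
        rw [div_pow, div_pow]; field_simp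
    _ ≤ _ := by gcongr

/-- Susceptibility bound for the number of large components. -/
lemma sum_prob_isComp_le (h0 : 0 ≤ p) (hnp : Fintype.card V * p < 1) (h1 : p ≤ 1) (k : ℕ) :
    (k : ℝ) ^ 2 * ∑ S : Finset V with k ≤ #S, prob p (fun G => IsComp G S) ≤
      Fintype.card V / (1 - Fintype.card V * p) := by
  classical
  have key : (k : ℝ) ^ 2 * ∑ S : Finset V with k ≤ #S, prob p (fun G => IsComp G S) ≤
      ∑ v : V, ∑ w : V, prob p (fun G => ReachIn G univ v w) := by
    unfold prob
    rw [← sum_product', ← expect_sum, ← expect_sum, ← expect_const_mul]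
    refine expect_mono h0 h1 fun G => ?_
    rw [sum_boole, sum_boole, filter_filter]
    have hsub : (univ.filter fun S : Finset V => k ≤ #S ∧ IsComp G S).biUnion (fun S => S ×ˢ S) ⊆
        (univ ×ˢ univ).filter fun x : V × V => ReachIn G univ x.1 x.2 := by
      intro x hx
      obtain ⟨S, hS, hxS⟩ := mem_biUnion.1 hx
      rw [mem_product] at hxS
      refine mem_filter.2 ⟨by simp, ?_⟩
      exact ((mem_filter.1 hS).2.2.2.1 _ hxS.1 _ hxS.2).mono (subset_univ S)
    have hdisj : ∀ S ∈ univ.filter fun S : Finset V => k ≤ #S ∧ IsComp G S,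
        ∀ T ∈ univ.filter fun S : Finset V => k ≤ #S ∧ IsComp G S, S ≠ T →
        Disjoint (S ×ˢ S) (T ×ˢ T) := by
      intro S hS T hT hne
      have := ((mem_filter.1 hS).2.2.eq_or_disjoint (mem_filter.1 hT).2.2).resolve_left hne
      exact disjoint_product.2 (.inl this)
    have hcard := card_le_card hsub
    rw [card_biUnion hdisj] at hcard
    have hlow : #(univ.filter fun S : Finset V => k ≤ #S ∧ IsComp G S) * k ^ 2 ≤
        ∑ S with k ≤ #S ∧ IsComp G S, #(S ×ˢ S) := by
      rw [← smul_eq_mul]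
      refine card_nsmul_le_sum _ _ _ fun S hS => ?_
      rw [card_product, sq]
      exact Nat.mul_le_mul (mem_filter.1 hS).2.1 (mem_filter.1 hS).2.1
    rw [mul_comm]
    exact_mod_cast hlow.trans hcard
  refine key.trans ((sum_le_sum fun v _ => sum_prob_reachIn_le h0 hnp univ v).trans_eq ?_)
  rw [sum_const, card_univ, nsmul_eq_mul, mul_one_div]

/-- The upper tail: the exponentially small factor comes from the comparison with the larger edge
probability `p'`, at which the susceptibility bound is applied. -/
lemma prob_exists_isComp_le (h0 : 0 < p) (hpp : p ≤ p') (h1 : p' < 1)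
    (hnp : Fintype.card V * p' < 1)
    (hr : p / p' * ((1 - p) / (1 - p')) ^ Fintype.card V ≤ 1) {k : ℕ} (hk : 1 ≤ k) :
    prob p (fun G : SimpleGraph V => ∃ S, k ≤ #S ∧ IsComp G S) ≤
      p' / p * (p / p' * ((1 - p) / (1 - p')) ^ Fintype.card V) ^ k *
        (Fintype.card V / (1 - Fintype.card V * p') / (k : ℝ) ^ 2) := by
  set r := p / p' * ((1 - p) / (1 - p')) ^ Fintype.card V
  have h0' : 0 < p' := h0.trans_le hpp
  have hq' : 0 < 1 - p' := by linarith
  have hq : 0 < 1 - p := by linarith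
  have hr0 : 0 ≤ r := by positivity
  have hkpos : (0 : ℝ) < k := by exact_mod_cast hk
  have hsum := sum_prob_isComp_le (V := V) h0'.le hnp h1.le k
  calc prob p (fun G : SimpleGraph V => ∃ S, k ≤ #S ∧ IsComp G S)
      ≤ ∑ S : Finset V with k ≤ #S, prob p (fun G => IsComp G S) := by
        refine prob_le_sum h0.le (hpp.trans h1.le) ?_
        rintro G ⟨S, hS, hc⟩
        exact ⟨S, by simpa using hS, hc⟩
    _ ≤ ∑ S : Finset V with k ≤ #S, p' / p * r ^ k * prob p' (fun G => IsComp G S) := by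
        refine sum_le_sum fun S hS => (prob_isComp_le_mul h0 hpp h1).trans ?_
        have hkS : k ≤ #S := (mem_filter.1 hS).2
        refine mul_le_mul_of_nonneg_right ?_ (prob_nonneg h0'.le h1.le)
        obtain ⟨m, hm⟩ : ∃ m, #S = m + 1 := ⟨#S - 1, by omega⟩
        have : (p / p') ^ (#S - 1) * ((1 - p) / (1 - p')) ^ (#S * Fintype.card V) =
            p' / p * r ^ #S := by
          rw [mul_pow, ← pow_mul, mul_comm #S, hm, Nat.add_sub_cancel, pow_succ]
          field_simp
        rw [this]
        exact mul_le_mul_of_nonneg_left (pow_le_pow_of_le_one hr0 hr hkS) (by positivity)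
    _ = p' / p * r ^ k * ∑ S : Finset V with k ≤ #S, prob p' (fun G => IsComp G S) := by
        rw [mul_sum]
    _ ≤ _ := by
        refine mul_le_mul_of_nonneg_left ?_ (by positivity)
        rw [le_div_iff₀ (by positivity), mul_comm]
        exact hsum

end Tilting

section SecondMoment

variable {V : Type*} [Fintype V] [DecidableEq V] {S T : Finset V} {p : ℝ}

lemma isComp_comap_iff (σ : Equiv.Perm V) (G : SimpleGraph V) :
    IsComp (G.comap σ) S ↔ IsComp G (S.map σ.toEmbedding) := by
  have hr : ∀ x y, ReachIn (G.comap σ) S x y ↔ ReachIn G (S.map σ.toEmbedding) (σ x) (σ y) := by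
    intro x y
    constructor
    · intro h
      exact Relation.ReflTransGen.lift σ (fun a b hab => ⟨hab.1, by simpa using hab.2⟩) _ _ h
    · intro h
      have := Relation.ReflTransGen.lift (p := fun a b => (G.comap σ).Adj a b ∧ a ∈ S ∧ b ∈ S)
        σ.symm (fun a b hab => ?_) _ _ h
      · simpa [Function.onFun, ReachIn] using this
      · have h2 := hab.2
        simp only [mem_map_equiv] at h2
        exact ⟨by simpa using hab.1, h2⟩
  refine and_congr (by simp) (and_congr ?_ ?_)
  · simp only [ConnIn, hr, forall_mem_map]
    rfl
  · constructor
    · intro h e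
      induction e with
      | h x y =>
        intro he
        have := h s(σ.symm x, σ.symm y) (by simpa [mem_crossPairs] using he)
        simpa using this
    · intro h e
      induction e with
      | h x y =>
        intro he
        have := h s(σ x, σ y) (by simpa [mem_crossPairs] using he)
        simpa using this

lemma prob_isComp_eq_of_card_eq (h : #S = #T) :
    prob p (fun G => IsComp G S) = prob p (fun G => IsComp G T) := by
  obtain ⟨σ, hσ⟩ : ∃ σ : Equiv.Perm V, S.map σ.toEmbedding = T := by
    have e : {x // x ∈ S} ≃ {x // x ∈ T} := Finset.equivOfCardEq h
    refine ⟨e.extendSubtype, eq_of_subset_of_card_le (fun y hy => ?_) (by rw [card_map, h])⟩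
    obtain ⟨x, hx, rfl⟩ := mem_map.1 hy
    exact e.extendSubtype_mem x hx
  rw [← hσ, ← prob_comap p (fun G => IsComp G S) σ]
  exact prob_congr fun G => isComp_comap_iff σ G

/-- Excluding `s` vertices loses at least as much room for a second component of size `j` as is
gained by sharing the `s j` forced non-edges. -/
lemma choose_sub_le {n s j : ℕ} (hs : s ≤ n) (hp : n * p ≤ 1) (h1 : p ≤ 1) :
    ((n - s).choose j : ℝ) ≤ n.choose j * (1 - p) ^ (s * j) := by
  rcases Nat.eq_zero_or_pos n with rfl | hn
  · obtain rfl : s = 0 := by omega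
    simp
  have hn' : (0 : ℝ) < n := by exact_mod_cast hn
  have hdesc : (n - s).descFactorial j * n ^ j ≤ n.descFactorial j * (n - s) ^ j := by
    induction j with
    | zero => simp
    | succ j ih =>
      rw [Nat.descFactorial_succ, Nat.descFactorial_succ, pow_succ, pow_succ]
      have : (n - s - j) * n ≤ (n - j) * (n - s) := by
        rcases le_or_gt (n - s) j with h | h
        · rw [Nat.sub_eq_zero_of_le h]; simp
        · zify [hs, h.le, (show j ≤ n by omega)]
          nlinarith [mul_nonneg (Int.natCast_nonneg s) (Int.natCast_nonneg j)]
      calc _ = ((n - s - j) * n) * ((n - s).descFactorial j * n ^ j) := by ring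
        _ ≤ ((n - j) * (n - s)) * (n.descFactorial j * (n - s) ^ j) := Nat.mul_le_mul this ih
        _ = _ := by ring
  have hchoose : ((n - s).choose j : ℝ) * n ^ j ≤ n.choose j * (n - s : ℕ) ^ j := by
    rw [Nat.descFactorial_eq_factorial_mul_choose, Nat.descFactorial_eq_factorial_mul_choose,
      mul_assoc, mul_assoc] at hdesc
    exact_mod_cast Nat.le_of_mul_le_mul_left hdesc j.factorial_pos
  have hbern : ((n - s : ℕ) : ℝ) / n ≤ (1 - p) ^ s := by
    have h := one_add_mul_le_pow (a := -p) (by linarith) s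
    rw [← sub_eq_add_neg] at h
    refine le_trans ?_ h
    rw [Nat.cast_sub hs, div_le_iff₀ hn']
    nlinarith [mul_nonneg (Nat.cast_nonneg (α := ℝ) s) (sub_nonneg.2 hp)]
  calc ((n - s).choose j : ℝ) ≤ n.choose j * (((n - s : ℕ) : ℝ) / n) ^ j := by
        rw [div_pow, ← mul_div_assoc, le_div_iff₀ (by positivity)]
        exact hchoose
    _ ≤ n.choose j * ((1 - p) ^ s) ^ j := by gcongr
    _ = _ := by rw [pow_mul]

open scoped Classical in
/-- The number of components of `G` whose sizes belong to `J`. -/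
noncomputable def compCount (G : SimpleGraph V) (J : Finset ℕ) : ℕ :=
  #{S : Finset V | #S ∈ J ∧ IsComp G S}

lemma sum_prob_isComp_disjoint_le (h0 : 0 ≤ p) (hp : Fintype.card V * p ≤ 1) (h1 : p < 1)
    (J : Finset ℕ) (hJ : 0 ∉ J) (hS : S.Nonempty) :
    ∑ T : Finset V with #T ∈ J ∧ Disjoint S T, prob p (fun G => IsComp G S ∧ IsComp G T) ≤
      prob p (fun G => IsComp G S) * ∑ T : Finset V with #T ∈ J, prob p (fun G => IsComp G T) := by
  have hq : 0 < 1 - p := by linarith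
  have hfib : ∀ (F : Finset (Finset V)) (f : Finset V → ℝ), (∀ T ∈ F, #T ∈ J) →
      ∑ T ∈ F, f T = ∑ j ∈ J, ∑ T ∈ F with #T = j, f T := fun F f hF =>
    (sum_fiberwise_of_maps_to hF f).symm
  rw [hfib _ _ fun T hT => (mem_filter.1 hT).2.1, hfib _ _ fun T hT => (mem_filter.1 hT).2, mul_sum]
  refine sum_le_sum fun j hj => ?_
  have hset1 : {T ∈ univ.filter fun T : Finset V => #T ∈ J ∧ Disjoint S T | #T = j} =
      powersetCard j Sᶜ := by
    ext T
    simp only [mem_filter, mem_univ, true_and, mem_powersetCard, subset_compl_iff_disjoint_left]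
    constructor
    · exact fun h => ⟨h.1.2, h.2⟩
    · exact fun h => ⟨⟨h.2 ▸ hj, h.1⟩, h.2⟩
  have hset2 : {T ∈ univ.filter fun T : Finset V => #T ∈ J | #T = j} = powersetCard j univ := by
    ext T
    simp only [mem_filter, mem_univ, true_and, mem_powersetCard, subset_univ]
    exact ⟨fun h => h.2, fun h => ⟨h ▸ hj, h⟩⟩
  rw [hset1, hset2]
  rcases (powersetCard j (univ : Finset V)).eq_empty_or_nonempty with he | ⟨T₀, hT₀⟩
  · have he' : powersetCard j Sᶜ = ∅ :=
      subset_empty.1 (he ▸ powersetCard_mono (subset_univ Sᶜ))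
    rw [he, he', sum_empty, sum_empty, mul_zero]
  rw [mem_powersetCard] at hT₀
  have hc : ∀ T ∈ powersetCard j (univ : Finset V),
      prob p (fun G => IsComp G T) = prob p (fun G => IsComp G T₀) := fun T hT =>
    prob_isComp_eq_of_card_eq ((mem_powersetCard.1 hT).2.trans hT₀.2.symm)
  have hle : ∀ T ∈ powersetCard j Sᶜ, prob p (fun G => IsComp G S ∧ IsComp G T) ≤
      prob p (fun G => IsComp G S) * prob p (fun G => IsComp G T₀) / (1 - p) ^ (#S * j) := by
    intro T hT
    have hTj := (mem_powersetCard.1 hT).2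
    have hd := subset_compl_iff_disjoint_left.1 (mem_powersetCard.1 hT).1
    have hTne : T.Nonempty := card_pos.1 (Nat.pos_of_ne_zero fun h => hJ (h ▸ hTj ▸ hj))
    rw [le_div_iff₀ (by positivity), mul_comm, ← hc T (mem_powersetCard.2 ⟨subset_univ _, hTj⟩),
      ← hTj]
    exact prob_isComp_and_isComp_le h0 h1.le hS hTne hd
  refine (sum_le_sum hle).trans ?_
  rw [sum_congr rfl hc, sum_const, sum_const, card_powersetCard, card_powersetCard, card_compl,
    card_univ, nsmul_eq_mul, nsmul_eq_mul, ← mul_div_assoc, div_le_iff₀ (by positivity)]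
  have hch := choose_sub_le (j := j) (card_le_univ S) hp h1.le
  have hnn : 0 ≤ prob p (fun G => IsComp G S) * prob p (fun G => IsComp G T₀) :=
    mul_nonneg (prob_nonneg h0 h1.le) (prob_nonneg h0 h1.le)
  calc _ ≤ ((Fintype.card V).choose j * (1 - p) ^ (#S * j)) *
        (prob p (fun G => IsComp G S) * prob p (fun G => IsComp G T₀)) :=
        mul_le_mul_of_nonneg_right hch hnn
    _ = _ := by ring

/-- The variance of the number of components with sizes in `J` is at most its mean `μ`, because
distinct components are negatively correlated; hence Chebyshev's inequality takes this form. -/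
lemma prob_compCount_lt_mul_sq_le (h0 : 0 ≤ p) (hp : Fintype.card V * p ≤ 1) (h1 : p < 1)
    (J : Finset ℕ) (hJ : 0 ∉ J) {μ : ℝ} {l : ℕ}
    (hμ : μ = ∑ S : Finset V with #S ∈ J, prob p (fun G => IsComp G S)) (hl : l ≤ μ) :
    prob p (fun G : SimpleGraph V => compCount G J < l) * (μ - l) ^ 2 ≤ μ := by
  classical
  have hX : ∀ G : SimpleGraph V, (compCount G J : ℝ) =
      ∑ S : Finset V with #S ∈ J, if IsComp G S then 1 else 0 := by
    intro G
    rw [sum_boole, filter_filter, compCount]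
  have hE : expect p (fun G : SimpleGraph V => (compCount G J : ℝ)) = μ := by
    simp only [hX]
    rw [expect_sum, hμ]
    rfl
  have hE2 : expect p (fun G : SimpleGraph V => (compCount G J : ℝ) ^ 2) ≤ μ + μ ^ 2 := by
    have hsq : ∀ G : SimpleGraph V, (compCount G J : ℝ) ^ 2 =
        ∑ S : Finset V with #S ∈ J, ∑ T : Finset V with #T ∈ J,
          if IsComp G S ∧ IsComp G T then 1 else 0 := by
      intro G
      rw [hX, sq, sum_mul_sum]
      refine sum_congr rfl fun S _ => sum_congr rfl fun T _ => ?_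
      by_cases hS : IsComp G S <;> by_cases hT : IsComp G T <;> simp [hS, hT]
    simp only [hsq]
    rw [expect_sum]
    simp only [expect_sum, expect_ite]
    have hrow : ∀ S ∈ univ.filter fun S : Finset V => #S ∈ J,
        ∑ T : Finset V with #T ∈ J,
          prob p (fun G => IsComp G S ∧ IsComp G T) ≤
        prob p (fun G => IsComp G S) + prob p (fun G => IsComp G S) * μ := by
      intro S hS
      have hSJ : #S ∈ J := (mem_filter.1 hS).2
      have hSne : S.Nonempty := card_pos.1 (Nat.pos_of_ne_zero fun h => hJ (h ▸ hSJ))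
      rw [← sum_filter_add_sum_filter_not _ (fun T => Disjoint S T), filter_filter, filter_filter,
        add_comm]
      refine add_le_add ?_ ?_
      · refine (sum_le_sum (g := fun T => if T = S then prob p (fun G => IsComp G S) else 0)
          fun T hT => ?_).trans ?_
        · have hnd := (mem_filter.1 hT).2.2
          split_ifs with hTS
          · exact prob_mono h0 h1.le fun G h => h.1
          · refine (prob_le_sum (ι := ℕ) (s := ∅) h0 h1.le (Q := fun _ _ => True)
              fun G hG => ?_).trans_eq sum_empty
            exact ((hG.1.eq_or_disjoint hG.2).elim (fun h => hTS h.symm) hnd).elim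
        · rw [sum_ite_eq']
          split_ifs
          · exact le_rfl
          · exact prob_nonneg h0 h1.le
      · rw [hμ]
        exact sum_prob_isComp_disjoint_le h0 hp h1 J hJ hSne
    refine (sum_le_sum hrow).trans_eq ?_
    rw [sum_add_distrib, ← sum_mul, ← hμ, sq]
  calc prob p (fun G : SimpleGraph V => compCount G J < l) * (μ - l) ^ 2
      = expect p (fun G : SimpleGraph V => (μ - l) ^ 2 * if compCount G J < l then 1 else 0) := by
        rw [expect_const_mul, expect_ite, mul_comm]
    _ ≤ expect p (fun G : SimpleGraph V =>
          ((compCount G J : ℝ) ^ 2 + (-2 * μ) * compCount G J) + μ ^ 2 * 1) := by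
        refine expect_mono h0 h1.le fun G => ?_
        split_ifs with h
        · have h' : (compCount G J : ℝ) ≤ l := by exact_mod_cast h.le
          nlinarith
        · nlinarith [sq_nonneg ((compCount G J : ℝ) - μ)]
    _ = expect p (fun G : SimpleGraph V => (compCount G J : ℝ) ^ 2) + (-2 * μ) * μ + μ ^ 2 := by
        rw [expect_add, expect_add, expect_const_mul, expect_const_mul, expect_one, hE, mul_one]
    _ ≤ μ := by nlinarith

end SecondMoment

/-! ### Ordered component sizes, and the counting estimate -/

section ComponentSizes

variable {V : Type*} [Fintype V] [DecidableEq V] {S : Finset V} {G : SimpleGraph V}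

lemma isComp_of_coe_eq_supp (C : G.ConnectedComponent) (hS : (S : Set V) = C.supp) :
    IsComp G S := by
  have hmem : ∀ x, x ∈ S ↔ G.connectedComponentMk x = C := fun x => by
    rw [← mem_coe, hS, SimpleGraph.ConnectedComponent.mem_supp_iff]
  have hadj : ∀ x y, G.Adj x y → x ∈ S → y ∈ S := fun x y h hx => by
    rw [hmem] at hx ⊢
    rw [← hx]
    exact SimpleGraph.ConnectedComponent.sound h.symm.reachable
  refine ⟨?_, ?_, ?_⟩
  · obtain ⟨x, hx⟩ := C.nonempty_supp
    exact ⟨x, by rw [← mem_coe, hS]; exact hx⟩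
  · intro x hx y hy
    have hxy : G.Reachable x y :=
      SimpleGraph.ConnectedComponent.exact (((hmem x).1 hx).trans ((hmem y).1 hy).symm)
    obtain ⟨q⟩ := hxy
    clear hy
    induction q with
    | nil => exact .refl
    | cons h _ ih => exact .head ⟨h, hx, hadj _ _ h hx⟩ (ih (hadj _ _ h hx))
  · intro e
    induction e with
    | h x y =>
      rw [mem_crossPairs, mem_compl, mem_compl]
      rintro (⟨hx, hy⟩ | ⟨hy, hx⟩) h
      · exact hy (hadj x y h hx)
      · exact hx (hadj y x (SimpleGraph.Adj.symm h) hy)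

lemma IsComp.exists_supp_eq (hS : IsComp G S) : ∃ C : G.ConnectedComponent, C.supp = S := by
  obtain ⟨x, hx⟩ := hS.1
  refine ⟨G.connectedComponentMk x, Set.ext fun y => ?_⟩
  rw [SimpleGraph.ConnectedComponent.mem_supp_iff, SimpleGraph.ConnectedComponent.eq, mem_coe]
  constructor
  · intro h
    obtain ⟨q⟩ := h.symm
    clear h
    induction q with
    | nil => exact hx
    | cons h _ ih => exact ih (hS.mem_of_adj hx h)
  · intro hy
    have := hS.2.1 x hx y hy
    clear hy
    induction this with
    | refl => exact .refl _
    | tail _ h ih => exact h.1.symm.reachable.trans ih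

lemma exists_isComp_of_le_componentSize {k l : ℕ} (hk : 1 ≤ k) (h : k ≤ G.componentSize l) :
    ∃ S, k ≤ #S ∧ IsComp G S := by
  classical
  rw [SimpleGraph.componentSize, List.getD_eq_getElem?_getD] at h
  by_cases hl : l - 1 < G.componentSizes.length
  · rw [List.getElem?_eq_getElem hl, Option.getD_some] at h
    have hmem := List.getElem_mem hl
    generalize G.componentSizes[l - 1] = s at h hmem
    rw [SimpleGraph.componentSizes, Multiset.mem_sort, Multiset.mem_map] at hmem
    obtain ⟨C, -, rfl⟩ := hmem
    refine ⟨C.supp.toFinset, ?_, isComp_of_coe_eq_supp C (Set.coe_toFinset _)⟩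
    rwa [← Set.ncard_eq_toFinset_card']
  · rw [List.getElem?_eq_none (not_lt.1 hl), Option.getD_none] at h
    omega

lemma compCount_lt_of_componentSize_lt {k l : ℕ} (hl : 1 ≤ l) (h : G.componentSize l < k)
    {J : Finset ℕ} (hJ : ∀ j ∈ J, k ≤ j) : compCount G J < l := by
  classical
  let hF : Fintype G.ConnectedComponent := Fintype.ofFinite _
  have h1 : compCount G J ≤ #{C : G.ConnectedComponent | k ≤ C.supp.ncard} := by
    have hsub : ({S : Finset V | #S ∈ J ∧ IsComp G S} : Finset (Finset V)) ⊆
        ({C : G.ConnectedComponent | k ≤ C.supp.ncard} : Finset _).image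
          fun C => C.supp.toFinset := by
      intro S hS
      obtain ⟨hSJ, hS⟩ := (mem_filter.1 hS).2
      obtain ⟨C, hC⟩ := hS.exists_supp_eq
      refine mem_image.2 ⟨C, mem_filter.2 ⟨mem_univ _, ?_⟩, ?_⟩
      · rw [hC, Set.ncard_coe_finset]
        exact hJ _ hSJ
      · rw [← coe_inj, Set.coe_toFinset, hC]
    exact (card_le_card hsub).trans card_image_le
  have h2 : #{C : G.ConnectedComponent | k ≤ C.supp.ncard} =
      G.componentSizes.countP fun s => k ≤ s := by
    rw [← Multiset.coe_countP, SimpleGraph.componentSizes, Multiset.sort_eq, Multiset.countP_map,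
      card_def, filter_val]
  have hsorted : G.componentSizes.Pairwise (· ≥ ·) := Multiset.pairwise_sort _ _
  rw [SimpleGraph.componentSize, List.getD_eq_getElem?_getD] at h
  have h3 : G.componentSizes.countP (fun s => k ≤ s) ≤ l - 1 := by
    conv_lhs => rw [← List.take_append_drop (l - 1) G.componentSizes]
    rw [List.countP_append]
    have hdrop : (G.componentSizes.drop (l - 1)).countP (fun s => k ≤ s) = 0 := by
      rw [List.countP_eq_zero]
      intro s hs
      obtain ⟨i, hi, rfl⟩ := List.mem_iff_getElem.1 hs
      rw [List.length_drop] at hi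
      rw [List.getElem_drop]
      rw [List.getElem?_eq_getElem (by omega), Option.getD_some] at h
      have hle : G.componentSizes[l - 1 + i] ≤ G.componentSizes[l - 1] := by
        rcases Nat.eq_zero_or_pos i with rfl | hi0
        · simp
        · exact List.pairwise_iff_getElem.1 hsorted (l - 1) (l - 1 + i) _ _ (by omega)
      simp only [decide_eq_true_eq, not_le]
      omega
    rw [hdrop, add_zero]
    exact List.countP_le_length.trans (List.length_take_le _ _)
  omega

/-- The bound by spanning trees for the expected number of components with sizes in `J`. -/
lemma le_sum_prob_isComp {p : ℝ} (h0 : 0 ≤ p) (h1 : p ≤ 1) {J : Finset ℕ} (hJ : ∀ j ∈ J, 1 ≤ j) :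
    ∑ j ∈ J, (Fintype.card V).choose j * ((j : ℝ) ^ (j - 1) * p ^ (j - 1) *
        (1 - p) ^ (j.choose 2 + j * (Fintype.card V - j)) / j) ≤
      ∑ S : Finset V with #S ∈ J, prob p (fun G => IsComp G S) := by
  have hq : 0 ≤ 1 - p := by linarith
  rw [← sum_fiberwise_of_maps_to (s := univ.filter fun S : Finset V => #S ∈ J) (g := card)
    fun S hS => (mem_filter.1 hS).2]
  refine sum_le_sum fun j hj => ?_
  have hset : {S ∈ univ.filter fun S : Finset V => #S ∈ J | #S = j} = powersetCard j univ := by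
    ext S
    simp only [mem_filter, mem_univ, true_and, mem_powersetCard, subset_univ]
    exact ⟨fun h => h.2, fun h => ⟨h ▸ hj, h⟩⟩
  rw [hset, ← card_univ, ← card_powersetCard, ← nsmul_eq_mul]
  refine card_nsmul_le_sum _ _ _ fun S hS => ?_
  obtain rfl := (mem_powersetCard.1 hS).2
  have hpos : (0 : ℝ) < #S := by exact_mod_cast hJ _ hj
  have hne : S.Nonempty := card_pos.1 (hJ _ hj)
  rw [prob_isComp hne, div_le_iff₀ hpos, pow_add, ← mul_assoc, card_univ]
  calc _ ≤ (#S * prob p fun G => ConnIn G S) * (1 - p) ^ (#S * (Fintype.card V - #S)) := by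
        exact mul_le_mul_of_nonneg_right (le_prob_connIn h0 h1 hne) (pow_nonneg hq _)
    _ = _ := by ring

end ComponentSizes

section Estimates

lemma exp_le_one_sub {x : ℝ} (h0 : 0 ≤ x) (h1 : x ≤ 1 / 2) :
    Real.exp (-(x + x ^ 2 / 2 + 2 * x ^ 3)) ≤ 1 - x := by
  have hx : |x| < 1 := by rw [abs_of_nonneg h0]; linarith
  have h := Real.abs_log_sub_add_sum_range_le hx 2
  rw [abs_of_nonneg h0, sum_range_succ, sum_range_one] at h
  have h3 : x ^ (2 + 1) / (1 - x) ≤ 2 * x ^ 3 := by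
    rw [div_le_iff₀ (by linarith)]
    norm_num
    nlinarith [mul_nonneg (pow_nonneg h0 3) (sub_nonneg.2 h1)]
  have h4 := (abs_le.1 h).1
  norm_num at h4
  rw [← Real.le_log_iff_exp_le (by linarith)]
  norm_num at h3
  linarith

lemma exp_le_one_sub' {x : ℝ} (h0 : 0 ≤ x) (h1 : x ≤ 1 / 2) :
    Real.exp (-(x + 2 * x ^ 2)) ≤ 1 - x := by
  refine le_trans (Real.exp_le_exp.2 ?_) (exp_le_one_sub h0 h1)
  nlinarith [mul_nonneg (sq_nonneg x) (sub_nonneg.2 h1)]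

/-- Stirling's upper bound, with the constant given by monotonicity of the Stirling sequence. -/
lemma factorial_le (j : ℕ) (hj : 1 ≤ j) :
    (j.factorial : ℝ) ≤ Real.exp 1 * Real.sqrt j * ((j : ℝ) ^ j * Real.exp (-j)) := by
  obtain ⟨m, rfl⟩ : ∃ m, j = m + 1 := ⟨j - 1, by omega⟩
  have h : Stirling.stirlingSeq (m + 1) ≤ Stirling.stirlingSeq 1 :=
    Stirling.stirlingSeq'_antitone (Nat.zero_le m)
  rw [Stirling.stirlingSeq_one, Stirling.stirlingSeq, div_le_iff₀ (by positivity)] at h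
  refine h.trans_eq ?_
  have h2 : Real.sqrt (2 * (m + 1 : ℕ)) = Real.sqrt 2 * Real.sqrt (m + 1 : ℕ) :=
    Real.sqrt_mul (by norm_num) _
  rw [h2, div_pow, Real.exp_neg, ← Real.exp_nat_mul, mul_one]
  have : Real.sqrt 2 ≠ 0 := by positivity
  field_simp

lemma le_choose {n j : ℕ} (hj : 2 * j ≤ n) (hn : 0 < n) :
    (n : ℝ) ^ j / j.factorial * Real.exp (-((j : ℝ) ^ 2 / (2 * n) + 2 * j ^ 3 / n ^ 2)) ≤
      n.choose j := by
  have hn' : (0 : ℝ) < n := by exact_mod_cast hn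
  have key : ∀ i : ℕ, i ≤ j → (n : ℝ) ^ i *
      Real.exp (-((i : ℝ) ^ 2 / (2 * n) + 2 * i ^ 3 / n ^ 2)) ≤ n.descFactorial i := by
    intro i
    induction i with
    | zero => simp
    | succ i ih =>
      intro hi
      have h := ih (by omega)
      have hin : (i : ℝ) / n ≤ 1 / 2 := by
        rw [div_le_div_iff₀ hn' (by norm_num)]
        have : i * 2 ≤ 1 * n := by omega
        exact_mod_cast this
      have hfac := exp_le_one_sub' (by positivity) hin
      rw [Nat.descFactorial_succ]
      push_cast [show i ≤ n by omega]
      calc (n : ℝ) ^ (i + 1) *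
            Real.exp (-(((i : ℝ) + 1) ^ 2 / (2 * n) + 2 * ((i : ℝ) + 1) ^ 3 / n ^ 2))
          ≤ (n : ℝ) ^ (i + 1) * Real.exp (-((i : ℝ) / n + 2 * (i / n) ^ 2) +
              -((i : ℝ) ^ 2 / (2 * n) + 2 * i ^ 3 / n ^ 2)) := by
            gcongr
            have e1 : (i : ℝ) / n = 2 * i / (2 * n) := by field_simp
            have e2 : 2 * ((i : ℝ) / n) ^ 2 = 2 * i ^ 2 / n ^ 2 := by rw [div_pow]; ring
            have e3 : (2 * (i : ℝ)) / (2 * n) + i ^ 2 / (2 * n) ≤ (i + 1) ^ 2 / (2 * n) := by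
              rw [← add_div]; gcongr; nlinarith
            have e4 : 2 * (i : ℝ) ^ 2 / n ^ 2 + 2 * i ^ 3 / n ^ 2 ≤ 2 * (i + 1) ^ 3 / n ^ 2 := by
              rw [← add_div]; gcongr
              nlinarith [sq_nonneg (i : ℝ), Nat.cast_nonneg (α := ℝ) i]
            rw [e2, e1]
            linarith
        _ = (n * Real.exp (-((i : ℝ) / n + 2 * (i / n) ^ 2))) *
            ((n : ℝ) ^ i * Real.exp (-((i : ℝ) ^ 2 / (2 * n) + 2 * i ^ 3 / n ^ 2))) := by
            rw [Real.exp_add, pow_succ]; ring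
        _ ≤ (n * (1 - i / n)) * n.descFactorial i :=
            mul_le_mul (mul_le_mul_of_nonneg_left hfac hn'.le) h (by positivity)
              (mul_nonneg hn'.le (by linarith))
        _ = _ := by
            field_simp
  rw [div_mul_eq_mul_div, div_le_iff₀ (by positivity)]
  refine (key j le_rfl).trans_eq ?_
  rw [Nat.descFactorial_eq_factorial_mul_choose]
  push_cast
  ring

/-- The spanning tree bound for the expected number of components of size `j`, made explicit by
Stirling's formula. In the range of sizes of interest all terms in the exponent but the first are
lower-order corrections. -/
lemma le_choose_mul {n j : ℕ} {ε p : ℝ} (hε0 : 0 < ε) (hε : ε ≤ 1 / 2) (hp : p = (1 - ε) / n)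
    (hj : 1 ≤ j) (hjn : 2 * j ≤ n) :
    n / (Real.exp 1 * Real.sqrt j * j ^ 2) * Real.exp (-(ε ^ 2 * j / 2 + 2 * ε ^ 3 * j +
        ε * j ^ 2 / (2 * n) + 2 * j / n + 2 * j ^ 3 / n ^ 2)) ≤
      n.choose j * ((j : ℝ) ^ (j - 1) * p ^ (j - 1) *
        (1 - p) ^ (j.choose 2 + j * (n - j)) / j) := by
  have hn : 0 < n := by omega
  have hn' : (0 : ℝ) < n := by exact_mod_cast hn
  have hn2 : (2 : ℝ) ≤ n := by
    have : 2 ≤ n := by omega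
    exact_mod_cast this
  have hj' : (0 : ℝ) < j := by exact_mod_cast hj
  have hnp : n * p = 1 - ε := by rw [hp]; field_simp
  have hp0 : 0 ≤ p := by rw [hp]; exact div_nonneg (by linarith) hn'.le
  have hp1 : p ≤ 1 / n := by rw [hp]; gcongr; linarith
  have hp2 : p ≤ 1 / 2 := hp1.trans (one_div_le_one_div_of_le (by norm_num) hn2)
  have hq0 : 0 < 1 - p := by linarith
  have hsq : 0 < Real.sqrt j := Real.sqrt_pos.2 hj'
  set M := j.choose 2 + j * (n - j) with hM
  have hMle : (M : ℝ) ≤ j * n - j ^ 2 / 2 := by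
    rw [hM]
    push_cast [Nat.cast_choose_two, show j ≤ n by omega]
    nlinarith
  have hMpos : 0 ≤ (j : ℝ) * n - j ^ 2 / 2 := (Nat.cast_nonneg M).trans hMle
  have hqM : Real.exp (-((1 - ε) * (j - j ^ 2 / (2 * n)) + 2 * j / n)) ≤ (1 - p) ^ M := by
    refine le_trans ?_ (pow_le_pow_left₀ (Real.exp_pos _).le (exp_le_one_sub' hp0 hp2) M)
    rw [← Real.exp_nat_mul, Real.exp_le_exp, mul_neg, neg_le_neg_iff]
    calc (M : ℝ) * (p + 2 * p ^ 2) ≤ (j * n - j ^ 2 / 2) * (p + 2 * p ^ 2) := by gcongr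
      _ = (n * p) * (j - j ^ 2 / (2 * n)) + (j * n - j ^ 2 / 2) * (2 * p ^ 2) := by
          field_simp
      _ ≤ (1 - ε) * (j - j ^ 2 / (2 * n)) + (j * n) * (2 * (1 / n) ^ 2) := by
          rw [hnp]
          gcongr
          nlinarith [sq_nonneg (j : ℝ)]
      _ = _ := by field_simp
  have hε1 : Real.exp (-(j * (ε + ε ^ 2 / 2 + 2 * ε ^ 3))) ≤ (1 - ε) ^ (j - 1) := by
    refine le_trans ?_ (pow_le_pow_of_le_one (by linarith) (by linarith) (Nat.sub_le j 1))
    refine le_trans (le_of_eq ?_)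
      (pow_le_pow_left₀ (Real.exp_pos _).le (exp_le_one_sub hε0.le hε) j)
    rw [← Real.exp_nat_mul, mul_neg]
  have hchoose := le_choose hjn hn
  have hfact := factorial_le j hj
  have hfpos : (0 : ℝ) < j.factorial := by exact_mod_cast j.factorial_pos
  have hppow : p ^ (j - 1) = n * ((1 - ε) ^ (j - 1) / n ^ j) := by
    obtain ⟨m, rfl⟩ : ∃ m, j = m + 1 := ⟨j - 1, by omega⟩
    rw [hp, Nat.add_sub_cancel, div_pow, pow_succ]
    field_simp
  have hjpow : (j : ℝ) ^ (j - 1) = j ^ j / j := by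
    obtain ⟨m, rfl⟩ : ∃ m, j = m + 1 := ⟨j - 1, by omega⟩
    rw [Nat.add_sub_cancel, pow_succ, mul_div_assoc, div_self hj'.ne', mul_one]
  calc _ = n / (j ^ 2) * (j ^ j / (Real.exp 1 * Real.sqrt j * ((j : ℝ) ^ j * Real.exp (-j)))) *
        (Real.exp (-((j : ℝ) ^ 2 / (2 * n) + 2 * j ^ 3 / n ^ 2)) *
        Real.exp (-(j * (ε + ε ^ 2 / 2 + 2 * ε ^ 3))) *
        Real.exp (-((1 - ε) * (j - j ^ 2 / (2 * n)) + 2 * j / n))) := by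
        rw [← Real.exp_add, ← Real.exp_add]
        have : (j : ℝ) ^ j / (Real.exp 1 * Real.sqrt j * ((j : ℝ) ^ j * Real.exp (-j))) =
            1 / (Real.exp 1 * Real.sqrt j) * Real.exp j := by
          rw [Real.exp_neg]
          field_simp
        rw [this, ← mul_assoc, mul_assoc _ (Real.exp j), ← Real.exp_add]
        congr 1
        · field_simp
        · congr 1
          ring
    _ ≤ n / (j ^ 2) * (j ^ j / j.factorial) *
        (Real.exp (-((j : ℝ) ^ 2 / (2 * n) + 2 * j ^ 3 / n ^ 2)) *
        (1 - ε) ^ (j - 1) * (1 - p) ^ M) := by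
        have : 0 ≤ (1 - ε) ^ (j - 1) := pow_nonneg (by linarith) _
        gcongr
    _ = ((n : ℝ) ^ j / j.factorial *
          Real.exp (-((j : ℝ) ^ 2 / (2 * n) + 2 * j ^ 3 / n ^ 2))) *
        ((j : ℝ) ^ (j - 1) * p ^ (j - 1) * (1 - p) ^ M / j) := by
        rw [hppow, hjpow]
        field_simp
    _ ≤ _ := by
        gcongr

end Estimates

/-! ### Estimates in the barely subcritical window -/

section Asymptotics

lemma one_sub_le_exp {x : ℝ} (h0 : 0 ≤ x) (h1 : x < 1) :
    1 - x ≤ Real.exp (-(x + x ^ 2 / 2)) := by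
  have hx : |x| < 1 := by rwa [abs_of_nonneg h0]
  have h := sum_le_hasSum (range 2) (fun i _ => by positivity)
    (Real.hasSum_pow_div_log_of_abs_lt_one hx)
  rw [sum_range_succ, sum_range_one] at h
  norm_num at h
  rw [← Real.log_le_iff_le_exp (by linarith)]
  linarith

/-- The factor gained per vertex by raising the edge probability from `(1 - ε) / n` to
`(1 - ε') / n`. -/
lemma tilt_le_exp {n : ℕ} {ε ε' p p' : ℝ} (hn : 2 ≤ n) (hε' : 0 ≤ ε') (hεε : ε' ≤ ε) (hε : ε < 1)
    (hp : p = (1 - ε) / n) (hp' : p' = (1 - ε') / n) :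
    p / p' * ((1 - p) / (1 - p')) ^ n ≤
      Real.exp (-((ε ^ 2 - ε' ^ 2) / 2 - 2 * ε / n)) := by
  have hn2 : (2 : ℝ) ≤ n := by exact_mod_cast hn
  have hn' : (0 : ℝ) < n := by linarith
  have hp'1 : p' ≤ 1 / n := by rw [hp']; gcongr; linarith
  have hp'2 : p' ≤ 1 / 2 := hp'1.trans (one_div_le_one_div_of_le (by norm_num) hn2)
  have hp'0 : 0 ≤ p' := by rw [hp']; exact div_nonneg (by linarith) hn'.le
  have hq' : 0 < 1 - p' := by linarith
  have hpp : p ≤ p' := by rw [hp, hp']; gcongr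
  have h1ε' : 0 < 1 - ε' := by linarith
  set d := ε - ε' with hd
  have hd0 : 0 ≤ d := by rw [hd]; linarith
  -- `p / p' = 1 - x` with `x = d / (1 - ε')`, and `x + x ^ 2 / 2` is at least `d + (ε² - ε'²) / 2`.
  have hratio : p / p' ≤ Real.exp (-(d + (ε ^ 2 - ε' ^ 2) / 2)) := by
    have hx0 : 0 ≤ d / (1 - ε') := by positivity
    have hx1 : d / (1 - ε') < 1 := by rw [div_lt_one h1ε', hd]; linarith
    have heq : p / p' = 1 - d / (1 - ε') := by
      rw [hp, hp', hd]
      field_simp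
      ring
    rw [heq]
    refine (one_sub_le_exp hx0 hx1).trans (Real.exp_le_exp.2 (neg_le_neg ?_))
    have h1 : d * (1 + ε') ≤ d / (1 - ε') := by
      rw [le_div_iff₀ h1ε']
      nlinarith [mul_nonneg hd0 (sq_nonneg ε')]
    have h2 : d ≤ d / (1 - ε') := by
      rw [le_div_iff₀ h1ε']
      nlinarith [mul_nonneg hd0 hε']
    have h3 : d ^ 2 ≤ (d / (1 - ε')) ^ 2 := by gcongr
    have h4 : (ε ^ 2 - ε' ^ 2) / 2 = d * ε' + d ^ 2 / 2 := by rw [hd]; ring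
    rw [h4]
    nlinarith
  have hbase : (1 - p) / (1 - p') ≤ Real.exp (d / n * (1 + 2 / n)) := by
    have hdn : p' - p = d / n := by rw [hp, hp', hd]; ring
    have h1 : (1 - p) / (1 - p') = (p' - p) / (1 - p') + 1 := by
      field_simp; ring
    rw [h1]
    refine (Real.add_one_le_exp _).trans (Real.exp_le_exp.2 ?_)
    rw [div_le_iff₀ hq', hdn]
    have h2 : 1 ≤ (1 + 2 / n) * (1 - p') := by
      have : (2 : ℝ) / n = 2 * (1 / n) := by ring
      rw [this]
      have hinv : (0 : ℝ) ≤ 1 / n := by positivity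
      have : (1 : ℝ) / n ≤ 1 / 2 := one_div_le_one_div_of_le (by norm_num) hn2
      nlinarith
    have h3 : 0 ≤ d / n := by positivity
    nlinarith
  have hq : 0 ≤ 1 - p := by linarith
  calc p / p' * ((1 - p) / (1 - p')) ^ n
      ≤ Real.exp (-(d + (ε ^ 2 - ε' ^ 2) / 2)) * Real.exp (d / n * (1 + 2 / n)) ^ n := by
        gcongr
    _ = Real.exp (-((ε ^ 2 - ε' ^ 2) / 2 - 2 * d / n)) := by
        rw [← Real.exp_nat_mul, ← Real.exp_add]
        congr 1
        field_simp
        ring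
    _ ≤ _ := by
        refine Real.exp_le_exp.2 (neg_le_neg (sub_le_sub_left ?_ _))
        gcongr
        rw [hd]; linarith

/-- Components of size at least `(1 + η) 2 ε⁻² L`, with `L = log (n ε³)`, are unlikely. -/
lemma prob_exists_isComp_le_exp {n : ℕ} {ε p η L : ℝ} {k : ℕ} (hn : 2 ≤ n) (hε0 : 0 < ε)
    (hε : ε ≤ 1 / 2) (hp : p = (1 - ε) / n) (hη0 : 0 < η) (hη : η ≤ 1 / 2) (hL : 1 ≤ L)
    (hy : n * ε ^ 3 = Real.exp L) (hsmall : 4 / Real.exp L ≤ η / 8)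
    (hk : (1 + η) * (2 * L / ε ^ 2) ≤ k) :
    prob p (fun G : SimpleGraph (Fin n) => ∃ S, k ≤ #S ∧ IsComp G S) ≤
      4 / η * Real.exp (-(η / 2 * L)) := by
  have hn2 : (2 : ℝ) ≤ n := by exact_mod_cast hn
  have hn' : (0 : ℝ) < n := by linarith
  -- Any fixed `δ` with `(1 + η) (1 - δ²) > 1 + η / 2` will do.
  set δ := η / 4 with hδ
  have hδ0 : 0 < δ := by positivity
  set ε' := δ * ε with hε'
  have hε'0 : 0 < ε' := by positivity
  have hε'ε : ε' ≤ ε := by rw [hε', hδ]; nlinarith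
  set p' := (1 - ε') / n with hp'
  have hp0 : 0 < p := by rw [hp]; exact div_pos (by linarith) hn'
  have hpp : p ≤ p' := by rw [hp, hp']; gcongr
  have hnp' : n * p' = 1 - ε' := by rw [hp']; field_simp
  have hp'1 : p' < 1 := by nlinarith
  have htilt := tilt_le_exp hn hε'0.le hε'ε (by linarith) hp hp'
  have herr : (1 - δ ^ 2 - 4 / Real.exp L) * (ε ^ 2 / 2) ≤ (ε ^ 2 - ε' ^ 2) / 2 - 2 * ε / n := by
    have h1 : 2 * ε / n ≤ 4 / Real.exp L * (ε ^ 2 / 2) := by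
      calc 2 * ε / n ≤ 2 * (1 / ε) / n := by
            gcongr
            rw [le_div_iff₀ hε0]
            nlinarith
        _ = _ := by rw [← hy]; field_simp; norm_num
    have h2 : (1 - δ ^ 2 - 4 / Real.exp L) * (ε ^ 2 / 2) =
        (ε ^ 2 - ε' ^ 2) / 2 - 4 / Real.exp L * (ε ^ 2 / 2) := by rw [hε']; ring
    rw [h2]
    exact sub_le_sub_left h1 _
  have hδη : δ ^ 2 ≤ η / 32 := by rw [hδ]; nlinarith
  have hc : 1 + η / 2 ≤ (1 + η) * (1 - δ ^ 2 - 4 / Real.exp L) := by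
    have h : 1 - 5 / 32 * η ≤ 1 - δ ^ 2 - 4 / Real.exp L := by linarith
    refine le_trans ?_ (mul_le_mul_of_nonneg_left h (by linarith))
    nlinarith
  have hc0 : 0 ≤ 1 - δ ^ 2 - 4 / Real.exp L := by linarith
  set r := p / p' * ((1 - p) / (1 - p')) ^ n with hr
  have hr1 : r ≤ 1 := by
    refine htilt.trans (Real.exp_le_one_iff.2 (neg_nonpos.2 (le_trans ?_ herr)))
    positivity
  have hD : 0 < 2 * L / ε ^ 2 := by positivity
  have hkpos : (0 : ℝ) < k := lt_of_lt_of_le (by positivity) hk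
  have hk1 : 1 ≤ k := by
    have : 0 < k := by exact_mod_cast hkpos
    exact this
  have hr0 : 0 ≤ r := mul_nonneg (div_nonneg hp0.le (hp0.le.trans hpp))
    (pow_nonneg (div_nonneg (by linarith) (by linarith)) _)
  have hrk : r ^ k ≤ Real.exp (-((1 + η / 2) * L)) := by
    refine (pow_le_pow_left₀ hr0 htilt k).trans ?_
    rw [← Real.exp_nat_mul, Real.exp_le_exp, mul_neg, neg_le_neg_iff]
    calc (1 + η / 2) * L ≤ ((1 + η) * (1 - δ ^ 2 - 4 / Real.exp L)) * L := by gcongr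
      _ = ((1 + η) * (2 * L / ε ^ 2)) * ((1 - δ ^ 2 - 4 / Real.exp L) * (ε ^ 2 / 2)) := by
          field_simp
      _ ≤ k * ((1 - δ ^ 2 - 4 / Real.exp L) * (ε ^ 2 / 2)) := by gcongr
      _ ≤ _ := by gcongr
  have hpr : p' / p ≤ 2 := by
    rw [div_le_iff₀ hp0, hp, hp', ← mul_div_assoc]
    gcongr
    linarith
  have hlast : (n : ℝ) / (1 - n * p') / (k : ℝ) ^ 2 ≤ Real.exp L / (4 * δ) := by
    have hkD : 2 * L / ε ^ 2 ≤ k := le_trans (by nlinarith) hk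
    have hkD' : 2 / ε ^ 2 ≤ k := le_trans (by gcongr; linarith) hkD
    rw [hnp', sub_sub_cancel, ← hy, hε']
    calc (n : ℝ) / (δ * ε) / (k : ℝ) ^ 2 ≤ n / (δ * ε) / (2 / ε ^ 2) ^ 2 := by gcongr
      _ = _ := by field_simp; norm_num
  have hmain := prob_exists_isComp_le (V := Fin n) hp0 hpp hp'1
    (by rw [Fintype.card_fin, hnp']; linarith) (by rw [Fintype.card_fin]; exact hr1) hk1
  rw [Fintype.card_fin] at hmain
  have hnn : 0 ≤ (n : ℝ) / (1 - n * p') / (k : ℝ) ^ 2 := by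
    rw [hnp', sub_sub_cancel]; positivity
  calc _ ≤ p' / p * r ^ k * ((n : ℝ) / (1 - n * p') / (k : ℝ) ^ 2) := hmain
    _ ≤ 2 * Real.exp (-((1 + η / 2) * L)) * (Real.exp L / (4 * δ)) := by gcongr
    _ = 2 / η * Real.exp (-(η / 2 * L)) := by
        have : Real.exp (-((1 + η / 2) * L)) = Real.exp (-(η / 2 * L)) / Real.exp L := by
          rw [← Real.exp_sub]; congr 1; ring
        rw [this, hδ]
        field_simp
    _ ≤ _ := by gcongr; norm_num

/-- The expected number of components with sizes between `(1 - η) 2 ε⁻² L` and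
`(1 - η / 2) 2 ε⁻² L`, where `L = log (n ε³)`, is large. -/
lemma le_sum_prob_isComp_Icc {n : ℕ} {ε p η L : ℝ} (hε0 : 0 < ε)
    (hε : ε ≤ η / 64) (hp : p = (1 - ε) / n) (hη0 : 0 < η) (hη : η ≤ 1 / 2) (hL : 2 ≤ η * L)
    (hy : n * ε ^ 3 = Real.exp L)
    (hsmall : 2 * L / Real.exp L + 4 / Real.exp L + 16 * L ^ 2 / Real.exp L ^ 2 ≤ η / 8) :
    Real.exp (η / 4 * L) / (8 * Real.exp 1 * L ^ 3) ≤
      ∑ S : Finset (Fin n) with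
        #S ∈ Icc ⌈(1 - η) * (2 * L / ε ^ 2)⌉₊ ⌊(1 - η / 2) * (2 * L / ε ^ 2)⌋₊,
        prob p (fun G => IsComp G S) := by
  have hL4 : 4 ≤ L := by nlinarith
  have hL1 : 1 ≤ L := by linarith
  set y := Real.exp L with hyL
  have hy0 : 0 < y := Real.exp_pos L
  have hnpos : (0 : ℝ) < n := by
    have : 0 < (n : ℝ) * ε ^ 3 := hy ▸ hy0
    exact pos_of_mul_pos_left this (by positivity)
  set D := 2 * L / ε ^ 2 with hD
  have hD0 : 0 < D := by positivity
  have hn0 : 0 < n := by exact_mod_cast hnpos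
  have hp0 : 0 ≤ p := by rw [hp]; exact div_nonneg (by linarith) hnpos.le
  have hp1 : p ≤ 1 := by
    rw [hp, div_le_one hnpos]
    have : (1 : ℝ) ≤ n := by exact_mod_cast hn0
    linarith
  have ht1 : 0 ≤ 2 * L / y := by positivity
  have ht2 : 0 ≤ 4 / y := by positivity
  have ht3 : 0 ≤ 16 * L ^ 2 / y ^ 2 := by positivity
  set J := Icc ⌈(1 - η) * D⌉₊ ⌊(1 - η / 2) * D⌋₊ with hJdef
  have hJ1 : ∀ j ∈ J, 1 ≤ j := by
    intro j hj
    refine le_trans ?_ (mem_Icc.1 hj).1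
    exact Nat.ceil_pos.2 (mul_pos (by linarith) hD0)
  have hterm : ∀ j ∈ J, ε ^ 2 * (Real.exp (η / 4 * L) / (8 * Real.exp 1 * L ^ 3)) ≤
      n.choose j * ((j : ℝ) ^ (j - 1) * p ^ (j - 1) *
        (1 - p) ^ (j.choose 2 + j * (n - j)) / j) := by
    intro j hj
    have hj1 := hJ1 j hj
    have hj0 : (0 : ℝ) < j := by exact_mod_cast hj1
    have hjle : (j : ℝ) ≤ (1 - η / 2) * D :=
      (Nat.le_floor_iff (mul_nonneg (by linarith) hD0.le)).1 (mem_Icc.1 hj).2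
    have hjD : (j : ℝ) ≤ D := hjle.trans (by nlinarith)
    have hjn : 2 * j ≤ n := by
      have h : (2 * j : ℝ) ≤ n := by
        refine (mul_le_mul_of_nonneg_left hjD (by norm_num)).trans ?_
        rw [hD, ← mul_div_assoc, div_le_iff₀ (by positivity)]
        have h1 : 2 * L ≤ 1 / 16 * y := by
          rw [← div_le_iff₀ hy0]; linarith
        rw [← hy] at h1
        have h2 : (n : ℝ) * ε ^ 3 ≤ n * ε ^ 2 := by
          refine mul_le_mul_of_nonneg_left ?_ hnpos.le
          exact pow_le_pow_of_le_one hε0.le (by linarith) (by norm_num)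
        nlinarith
      exact_mod_cast h
    refine le_trans ?_ (le_choose_mul hε0 (by linarith) hp hj1 hjn)
    have hexp : ε ^ 2 * j / 2 + 2 * ε ^ 3 * j + ε * j ^ 2 / (2 * n) + 2 * j / n +
        2 * j ^ 3 / n ^ 2 ≤ (1 - η / 4) * L := by
      have e1 : ε ^ 2 * j / 2 ≤ (1 - η / 2) * L := by
        calc ε ^ 2 * j / 2 ≤ ε ^ 2 * ((1 - η / 2) * D) / 2 := by gcongr
          _ = _ := by rw [hD]; field_simp
      have e2 : 2 * ε ^ 3 * j ≤ 4 * ε * L := by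
        calc 2 * ε ^ 3 * j ≤ 2 * ε ^ 3 * D := by gcongr
          _ = _ := by rw [hD]; field_simp; norm_num
      have e3 : ε * j ^ 2 / (2 * n) ≤ 2 * L / y * L := by
        calc ε * j ^ 2 / (2 * n) ≤ ε * D ^ 2 / (2 * n) := by gcongr
          _ = _ := by rw [hD, ← hy]; field_simp
      have e4 : 2 * j / n ≤ 4 / y * L := by
        calc (2 * j / n : ℝ) ≤ 2 * D / n := by gcongr
          _ = (4 / y * L) * ε := by rw [hD, ← hy]; field_simp; norm_num
          _ ≤ 4 / y * L := mul_le_of_le_one_right (by positivity) (by linarith)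
      have e5 : 2 * j ^ 3 / n ^ 2 ≤ 16 * L ^ 2 / y ^ 2 * L := by
        calc (2 * j ^ 3 / n ^ 2 : ℝ) ≤ 2 * D ^ 3 / n ^ 2 := by gcongr
          _ = _ := by rw [hD, ← hy]; field_simp; norm_num
      have e6 := mul_le_mul_of_nonneg_right hsmall (by linarith : 0 ≤ L)
      have e7 := mul_le_mul_of_nonneg_right hε (by linarith : 0 ≤ L)
      have e8 : 0 < η * L := by positivity
      linarith
    have hsqrt : Real.sqrt j ≤ 2 * L / ε := by
      rw [Real.sqrt_le_left (by positivity)]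
      refine hjD.trans ?_
      rw [hD, div_pow]
      gcongr
      nlinarith
    calc ε ^ 2 * (Real.exp (η / 4 * L) / (8 * Real.exp 1 * L ^ 3))
        = n / (Real.exp 1 * (2 * L / ε) * D ^ 2) * Real.exp (-((1 - η / 4) * L)) := by
          have : Real.exp (-((1 - η / 4) * L)) = Real.exp (η / 4 * L) / (n * ε ^ 3) := by
            rw [hy, hyL, ← Real.exp_sub]; congr 1; ring
          rw [this, hD]
          field_simp
          norm_num
      _ ≤ n / (Real.exp 1 * Real.sqrt j * j ^ 2) * Real.exp (-(ε ^ 2 * j / 2 + 2 * ε ^ 3 * j +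
          ε * j ^ 2 / (2 * n) + 2 * j / n + 2 * j ^ 3 / n ^ 2)) := by
          gcongr
  have hcard : 1 / ε ^ 2 ≤ (#J : ℝ) := by
    have hfl : (1 - η / 2) * D < ⌊(1 - η / 2) * D⌋₊ + 1 := Nat.lt_floor_add_one _
    have hce : (⌈(1 - η) * D⌉₊ : ℝ) < (1 - η) * D + 1 :=
      Nat.ceil_lt_add_one (mul_nonneg (by linarith) hD0.le)
    have hc : (⌊(1 - η / 2) * D⌋₊ : ℝ) + 1 - ⌈(1 - η) * D⌉₊ ≤ #J := by
      rw [hJdef, Nat.card_Icc]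
      have : ⌊(1 - η / 2) * D⌋₊ + 1 ≤
          (⌊(1 - η / 2) * D⌋₊ + 1 - ⌈(1 - η) * D⌉₊) + ⌈(1 - η) * D⌉₊ := le_tsub_add
      have h' : ((⌊(1 - η / 2) * D⌋₊ + 1 : ℕ) : ℝ) ≤
          ((⌊(1 - η / 2) * D⌋₊ + 1 - ⌈(1 - η) * D⌉₊ : ℕ) : ℝ) + ⌈(1 - η) * D⌉₊ := by
        exact_mod_cast this
      push_cast at h' ⊢
      linarith
    have hlow : η / 2 * D - 1 ≤ #J := by linarith
    refine le_trans ?_ hlow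
    have h1 : η / 2 * D = (η * L) * (1 / ε ^ 2) := by rw [hD]; field_simp
    have h2 : 1 ≤ 1 / ε ^ 2 := by
      rw [one_le_div (by positivity)]
      nlinarith
    rw [h1]
    nlinarith
  have hm0 : 0 ≤ Real.exp (η / 4 * L) / (8 * Real.exp 1 * L ^ 3) := by positivity
  have hsum := le_sum_prob_isComp (V := Fin n) hp0 hp1 hJ1
  rw [Fintype.card_fin] at hsum
  refine le_trans ?_ hsum
  refine le_trans ?_ (card_nsmul_le_sum J _ _ hterm)
  rw [nsmul_eq_mul, ← mul_assoc]
  refine le_mul_of_one_le_left hm0 ?_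
  rw [div_le_iff₀ (by positivity)] at hcard
  exact hcard

/-- Both tails together, as a bound that depends on `n` through `L = log (n ε³)` only. -/
lemma prob_componentSize_le {n l : ℕ} {ε p η L m : ℝ} (hl : 1 ≤ l) (hn : 2 ≤ n) (hε0 : 0 < ε)
    (hε : ε ≤ η / 64) (hp : p = (1 - ε) / n) (hη0 : 0 < η) (hη : η ≤ 1 / 2) (hL : 2 ≤ η * L)
    (hy : n * ε ^ 3 = Real.exp L)
    (hsmall : 2 * L / Real.exp L + 4 / Real.exp L + 16 * L ^ 2 / Real.exp L ^ 2 ≤ η / 8)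
    (hm : m = Real.exp (η / 4 * L) / (8 * Real.exp 1 * L ^ 3)) (hml : 2 * l ≤ m) :
    prob p (fun G : SimpleGraph (Fin n) =>
        η < |(G.componentSize l : ℝ) / (2 * L / ε ^ 2) - 1|) ≤
      4 / η * Real.exp (-(η / 2 * L)) + 4 / m := by
  have hL1 : 1 ≤ L := by nlinarith
  have hn2 : (2 : ℝ) ≤ n := by exact_mod_cast hn
  have hp0 : 0 ≤ p := by rw [hp]; exact div_nonneg (by linarith) (by linarith)
  have hp1 : p < 1 := by rw [hp, div_lt_one (by linarith)]; linarith
  set D := 2 * L / ε ^ 2 with hD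
  have hD0 : 0 < D := by positivity
  set k := ⌈(1 + η) * D⌉₊
  set k' := ⌈(1 - η) * D⌉₊ with hk'
  set J := Icc k' ⌊(1 - η / 2) * D⌋₊
  have hk0 : 1 ≤ k := Nat.ceil_pos.2 (mul_pos (by linarith) hD0)
  have hk'0 : 1 ≤ k' := Nat.ceil_pos.2 (mul_pos (by linarith) hD0)
  have hup := prob_exists_isComp_le_exp (k := k) hn hε0 (by linarith) hp hη0 hη hL1 hy (by
    have h1 : 0 ≤ 2 * L / Real.exp L := by positivity
    have h2 : 0 ≤ 16 * L ^ 2 / Real.exp L ^ 2 := by positivity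
    linarith) (Nat.le_ceil _)
  have hμ := le_sum_prob_isComp_Icc hε0 hε hp hη0 hη hL hy hsmall
  rw [← hm] at hμ
  set μ := ∑ S : Finset (Fin n) with #S ∈ J, prob p (fun G => IsComp G S) with hμdef
  have hlpos : (1 : ℝ) ≤ l := by exact_mod_cast hl
  have hcheb := prob_compCount_lt_mul_sq_le (V := Fin n) (l := l) hp0
    (by rw [Fintype.card_fin, hp, mul_div_cancel₀ _ (by linarith)]; linarith) hp1 J
    (fun h => absurd (mem_Icc.1 h).1 (by omega)) hμdef (by linarith)
  have hlow : prob p (fun G : SimpleGraph (Fin n) => compCount G J < l) ≤ 4 / m := by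
    have hmpos : 0 < m := by linarith
    have hμpos : 0 < μ := by linarith
    have hhalf : μ / 2 ≤ μ - l := by linarith
    have hP := prob_nonneg (P := fun G : SimpleGraph (Fin n) => compCount G J < l) hp0 hp1.le
    refine le_trans ?_ (div_le_div_of_nonneg_left (by norm_num) hmpos hμ)
    rw [le_div_iff₀ hμpos]
    have h1 : prob p (fun G : SimpleGraph (Fin n) => compCount G J < l) * (μ / 2) ^ 2 ≤ μ :=
      le_trans (by gcongr) hcheb
    have h2 : μ * (prob p (fun G : SimpleGraph (Fin n) => compCount G J < l) * μ) ≤ μ * 4 := by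
      nlinarith
    exact le_of_mul_le_mul_left h2 hμpos
  refine le_trans ?_ (add_le_add hup hlow)
  refine (prob_le_sum (s := (univ : Finset Bool)) hp0 hp1.le (Q := fun b G => if b then
    ∃ S, k ≤ #S ∧ IsComp G S else compCount G J < l) fun G hG => ?_).trans_eq (by simp)
  rcases lt_abs.1 hG with h | h
  · refine ⟨true, mem_univ _, ?_⟩
    simp only [if_true]
    refine exists_isComp_of_le_componentSize hk0 (l := l) (Nat.ceil_le.2 ?_)
    rw [← le_div_iff₀ hD0]
    linarith
  · refine ⟨false, mem_univ _, ?_⟩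
    simp only [Bool.false_eq_true, if_false]
    refine compCount_lt_of_componentSize_lt hl (k := k') (Nat.lt_ceil.2 ?_)
      fun j hj => (mem_Icc.1 hj).1
    rw [← div_lt_iff₀ hD0]
    linarith

end Asymptotics

end RandomGraph

open RandomGraph in
theorem theorem1 (ε : ℕ → ℝ) (p : ℕ → unitInterval)
    (hε : Tendsto ε atTop (𝓝 0))
    (hε_window : Tendsto (fun n : ℕ => ε n * (n : ℝ) ^ (1 / 3 : ℝ)) atTop atTop)
    (hp : ∀ᶠ n : ℕ in atTop, (p n : ℝ) = (1 - ε n) / n)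
    (η : ℝ) (hη : 0 < η) (l : ℕ) (hl : 1 ≤ l) :
    Tendsto
      (fun n : ℕ => SimpleGraph.binomialRandom (Fin n) (p n)
        {G : SimpleGraph (Fin n) |
          η < |(G.componentSize l : ℝ) /
              (2 * (ε n) ^ (-2 : ℤ) * Real.log ((n : ℝ) * (ε n) ^ 3)) - 1|})
      atTop (𝓝 0) := by
  -- The lower tail needs `(1 - η) > 0`, and the event only grows if `η` is decreased.
  set κ := min η (1 / 2) with hκ
  have hκ0 : 0 < κ := lt_min hη (by norm_num)
  have hκ1 : κ ≤ 1 / 2 := min_le_right _ _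
  have hεpos : ∀ᶠ n : ℕ in atTop, 0 < ε n := by
    filter_upwards [hε_window.eventually_gt_atTop 0] with n h
    exact pos_of_mul_pos_left h (by positivity)
  have hy : Tendsto (fun n : ℕ => (n : ℝ) * ε n ^ 3) atTop atTop := by
    refine ((tendsto_pow_atTop (n := 3) (by norm_num)).comp hε_window).congr fun n => ?_
    simp only [Function.comp]
    rw [mul_pow, ← Real.rpow_natCast ((n : ℝ) ^ (1 / 3 : ℝ)), ← Real.rpow_mul (Nat.cast_nonneg n)]
    norm_num
    ring
  set L : ℕ → ℝ := fun n => Real.log ((n : ℝ) * ε n ^ 3) with hL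
  have hLtop : Tendsto L atTop atTop := Real.tendsto_log_atTop.comp hy
  have hdiv : ∀ k : ℕ, ∀ c : ℝ, 0 < c →
      Tendsto (fun x : ℝ => x ^ k / Real.exp (c * x)) atTop (𝓝 0) := by
    intro k c hc
    have h := Real.tendsto_pow_mul_exp_neg_atTop_nhds_zero k
    have h2 := (h.comp (tendsto_id.const_mul_atTop hc)).const_mul ((c ^ k)⁻¹)
    rw [mul_zero] at h2
    refine h2.congr fun x => ?_
    simp only [Function.comp, id, mul_pow, Real.exp_neg]
    field_simp
  set m : ℝ → ℝ := fun x => Real.exp (κ / 4 * x) / (8 * Real.exp 1 * x ^ 3) with hm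
  have hminv : Tendsto (fun x => 4 / m x) atTop (𝓝 0) := by
    have h := (hdiv 3 (κ / 4) (by positivity)).const_mul (4 * (8 * Real.exp 1))
    rw [mul_zero] at h
    refine h.congr fun x => ?_
    simp only [hm]
    rw [div_div_eq_mul_div]
    ring
  have hbound : Tendsto (fun x => 4 / κ * Real.exp (-(κ / 2 * x)) + 4 / m x) atTop (𝓝 0) := by
    have h := ((hdiv 0 (κ / 2) (by positivity)).const_mul (4 / κ)).add hminv
    rw [mul_zero, add_zero] at h
    refine h.congr fun x => ?_
    rw [pow_zero, Real.exp_neg, one_div]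
  have herr : Tendsto (fun x => 2 * x / Real.exp x + 4 / Real.exp x +
      16 * x ^ 2 / Real.exp x ^ 2) atTop (𝓝 0) := by
    have h := (((hdiv 1 1 one_pos).const_mul 2).add ((hdiv 0 1 one_pos).const_mul 4)).add
      ((hdiv 2 2 two_pos).const_mul 16)
    simp only [mul_zero, add_zero] at h
    refine h.congr fun x => ?_
    rw [two_mul x, Real.exp_add]
    ring_nf
  have hlim : Tendsto (fun n => ENNReal.ofReal
      (4 / κ * Real.exp (-(κ / 2 * L n)) + 4 / m (L n))) atTop (𝓝 0) := by
    rw [← ENNReal.ofReal_zero]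
    exact (ENNReal.continuous_ofReal.tendsto 0).comp (hbound.comp hLtop)
  refine tendsto_of_tendsto_of_tendsto_of_le_of_le' tendsto_const_nhds hlim
    (Eventually.of_forall fun _ => bot_le) ?_
  have hlpos : (0 : ℝ) < l := by exact_mod_cast hl
  filter_upwards [hεpos, hp, eventually_ge_atTop 2, hy.eventually_gt_atTop 0,
    hε.eventually_le_const (show (0 : ℝ) < κ / 64 by positivity),
    hLtop.eventually_ge_atTop (2 / κ), (herr.comp hLtop).eventually_le_const
      (show (0 : ℝ) < κ / 8 by positivity), (hminv.comp hLtop).eventually_le_const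
      (show (0 : ℝ) < 2 / l by positivity)] with n hn0 hpn hn2 hyn hεn hLn herrn hmn
  rw [binomialRandom_eq_ofReal_prob, hpn]
  refine ENNReal.ofReal_le_ofReal ?_
  have hLpos : 0 < L n := lt_of_lt_of_le (by positivity) hLn
  have hmpos : 0 < m (L n) := by simp only [hm]; positivity
  have hml : 2 * l ≤ m (L n) := by
    simp only [Function.comp] at hmn
    rw [div_le_div_iff₀ hmpos hlpos] at hmn
    linarith
  have hpI := (p n).2
  rw [hpn] at hpI
  refine le_trans (prob_mono hpI.1 hpI.2 fun G hG => ?_)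
    (prob_componentSize_le (L := L n) (m := m (L n)) hl hn2 hn0 hεn rfl hκ0 hκ1
      (by rwa [div_le_iff₀' hκ0] at hLn) (Real.exp_log hyn).symm herrn rfl hml)
  have hD : 2 * ε n ^ (-2 : ℤ) * Real.log ((n : ℝ) * ε n ^ 3) = 2 * L n / ε n ^ 2 := by
    rw [zpow_neg, div_eq_mul_inv, mul_right_comm]
    rfl
  rw [hD] at hG
  exact (min_le_left _ _).trans_lt hG
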